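/- **Definitions.** A Frölicher space is a set $X$ with a set $C_X$ of curves $\mathbb R\to X$ and a set $F_X$ of functions $X\to\mathbb R$ such that $C_X=\{c: f\circ c \text{ is } C^\infty\ \forall f\in F_X\}$ and $F_X=\{f: f\circ c\text{ is } C^\infty\ \forall c\in C_X\}$; smooth mappings preserve curves, $\mathbf{FS}$ is the resulting category, and $X^Y$ is its exponential. A Weil algebra is a finite-dimensional commutative real algebra $W=\mathbb R\oplus N$ whose ideal $N$ consists of nilpotent elements; $\mathbf W$ is the category of Weil algebras, regarded as a full subcategory of the category of $C^\infty$-algebras, and $\otimes_\infty$ is the coproduct of $C^\infty$-algebras. For $W=C^\infty(\mathbb R^k)/I$ a Weil algebra whose augmentation $W\to\mathbb R$ is evaluation at $0$, the Weil prolongation $X\otimes W$ is the set of smooth mappings $f:\mathbb R^k\to X$ modulo the relation $f\sim g$ iff $f(0)=g(0)$ and $\chi\circ f-\chi\circ g\in I$ for all $\chi\in F_X$, with the quotient Frölicher structure of $X^{\mathbb R^k}$; this is a bifunctor $\mathbf{FS}\times\mathbf W\to\mathbf{FS}$. The space $X$ is Weil exponentiable if $(X\otimes(W_1\otimes_\infty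 W_2))^Y\cong (X\otimes W_1)^Y\otimes W_2$ naturally in the Frölicher space $Y$ and the Weil algebras $W_1,W_2$; $\mathbf{FS_{WE}}$ is the full subcategory of Weil exponentiable spaces. A finite limit diagram of Weil algebras is a cone of Weil algebras over a finite diagram of Weil algebras that is a limit cone of $C^\infty$-algebras (equivalently, of real algebras). The space $X$ is microlinear if for every finite limit diagram $\mathcal D$ of Weil algebras $X\otimes\mathcal D$ is a limit diagram in $\mathbf{FS}$. Let $\mathbf D$ be the full subcategory of the category of $C^\infty$-algebras on the objects of the form $C^\infty(\mathbb R^n)\otimes_\infty W$ with $n\in\mathbb N$ and $W$ a Weil algebra; a Weil algebra $W$ is identified with the object $C^\infty(\mathbb R^0)\otimes_\infty W$. A functor $M:\mathbf D\to\mathbf{Sets}$ is microlinear if for every finite limit diagram $\mathcal D$ of Weil algebras the diagram $M^{\hom_{\mathbf D}(\mathcal D,\cdot)}$, obtained by replacing each $W$ in $\mathcal D$ by the exponential $M^{\hom_{\mathbf D}(W,\cdot)}$, is a limit diagram of functors on $\mathbf D$. **Theorem.** Assume that there is a bifunctor $\otimes:\mathbf{FS_{WE}}\times\mathbf D\to\mathbf{FS_{WE}}$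 with $$X\otimes (C^\infty(\mathbb R^n)\otimes_\infty W)\cong X^{\mathbb R^n}\otimes W$$ for every $n$, naturally in $X\in\mathbf{FS_{WE}}$ and $W\in\mathbf W$. For any such bifunctor let $\mathbf J:\mathbf{FS_{WE}}\to\mathbf{Sets}^{\mathbf D}$ be the functor that sends $X$ to the functor $C\mapsto$ (underlying set of $X\otimes C$). Then $\mathbf J$ preserves microlinearity: if $X$ is a Weil exponentiable and microlinear Frölicher space, then $\mathbf J(X)$ is microlinear. -/

import Mathlib

open CategoryTheory CategoryTheory.Limits
open scoped ContDiff TensorProduct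

namespace WeilFrolicher

noncomputable section

/-! ## Hadamard's lemma -/

theorem contDiff_integral_aux {E : Type} [NormedAddCommGroup E] [NormedSpace ℝ E] [ProperSpace E]
    (n : ℕ) : ∀ (G : Type) [NormedAddCommGroup G] [NormedSpace ℝ G] [CompleteSpace G]
      (F : E → ℝ → G), ContDiff ℝ ∞ (Function.uncurry F) →
      ContDiff ℝ n (fun x => ∫ t in (0 : ℝ)..1, F x t) := by
  induction n with
  | zero =>
    intro G _ _ _ F hF
    exact contDiff_zero.2
      (intervalIntegral.continuous_parametric_intervalIntegral_of_continuous' hF.continuous 0 1)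
  | succ n ih =>
    intro G _ _ _ F hF
    have hd : ∀ x t, HasFDerivAt (fun y => F y t)
        ((fderiv ℝ (Function.uncurry F) (x, t)).comp (ContinuousLinearMap.inl ℝ E ℝ)) x := by
      intro x t
      have h1 : HasFDerivAt (Function.uncurry F) (fderiv ℝ (Function.uncurry F) (x, t)) (x, t) :=
        (hF.differentiable (by simp) (x, t)).hasFDerivAt
      exact HasFDerivAt.comp (g := Function.uncurry F) (f := fun y => (y, t)) x h1
        (hasFDerivAt_prodMk_left x t)
    let F' : E → ℝ → (E →L[ℝ] G) := fun x t =>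
      (fderiv ℝ (Function.uncurry F) (x, t)).comp (ContinuousLinearMap.inl ℝ E ℝ)
    have hF' : ContDiff ℝ ∞ (Function.uncurry F') := by
      have : ContDiff ℝ ∞ (fderiv ℝ (Function.uncurry F)) := hF.fderiv_right (by simp)
      exact this.clm_comp contDiff_const
    rw [Nat.cast_succ]
    refine contDiff_succ_iff_hasFDerivAt.2 ⟨_, ih _ F' hF', fun x => ?_⟩
    obtain ⟨C, hC⟩ := ((isCompact_closedBall x 1).prod
      (isCompact_uIcc (a := (0 : ℝ)) (b := 1))).exists_bound_of_continuousOn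
        hF'.continuous.continuousOn
    have cont : ∀ y, Continuous (F y) := fun y =>
      hF.continuous.comp (Continuous.prodMk_right y)
    have cont' : ∀ y, Continuous (F' y) := fun y =>
      hF'.continuous.comp (Continuous.prodMk_right y)
    refine intervalIntegral.hasFDerivAt_integral_of_dominated_of_fderiv_le
      (bound := fun _ => C) (Metric.closedBall_mem_nhds x one_pos)
      (Filter.Eventually.of_forall fun y => (cont y).aestronglyMeasurable)
      ((cont x).intervalIntegrable 0 1) (cont' x).aestronglyMeasurable
      (Filter.Eventually.of_forall fun t ht y hy => hC (y, t) ⟨hy, Set.uIoc_subset_uIcc ht⟩)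
      intervalIntegrable_const (Filter.Eventually.of_forall fun t _ y _ => hd y t)

/-- Hadamard's lemma. -/
theorem hadamard {n : ℕ} (h : (Fin n → ℝ) → ℝ) (hh : ContDiff ℝ ∞ h) (r : Fin n → ℝ) :
    ∃ g : Fin n → (Fin n → ℝ) → ℝ, (∀ i, ContDiff ℝ ∞ (g i)) ∧
      ∀ x, h x = h r + ∑ i, (x i - r i) * g i x := by
  have hsm : ContDiff ℝ ∞ (fun p : (Fin n → ℝ) × ℝ => fderiv ℝ h (r + p.2 • (p.1 - r))) := by
    have : ContDiff ℝ ∞ (fderiv ℝ h) := hh.fderiv_right (by simp)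
    exact this.comp (by fun_prop)
  refine ⟨fun i x => ∫ t in (0 : ℝ)..1, fderiv ℝ h (r + t • (x - r)) (Pi.single i 1),
    fun i => contDiff_infty.2 fun m => contDiff_integral_aux m ℝ _
      (hsm.clm_apply contDiff_const), fun x => ?_⟩
  have hcont : ∀ v : Fin n → ℝ, Continuous (fun t : ℝ => fderiv ℝ h (r + t • (x - r)) v) :=
    fun v => (hsm.continuous.comp (by fun_prop : Continuous fun t : ℝ => (x, t))).clm_apply
      continuous_const
  have key : ∫ t in (0 : ℝ)..1, fderiv ℝ h (r + t • (x - r)) (x - r) = h x - h r := by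
    have hder : ∀ t : ℝ, HasDerivAt (fun t : ℝ => h (r + t • (x - r)))
        (fderiv ℝ h (r + t • (x - r)) (x - r)) t := by
      intro t
      have h1 := (hh.differentiable (by simp) (r + t • (x - r))).hasFDerivAt
      have h2 : HasDerivAt (fun t : ℝ => r + t • (x - r)) (x - r) t := by
        simpa using ((hasDerivAt_id t).smul_const (x - r)).const_add r
      exact h1.comp_hasDerivAt t h2
    rw [intervalIntegral.integral_eq_sub_of_hasDerivAt (fun t _ => hder t)
      ((hcont _).intervalIntegrable _ _)]
    simp
  have : ∀ t : ℝ, fderiv ℝ h (r + t • (x - r)) (x - r) =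
      ∑ i, (x i - r i) * fderiv ℝ h (r + t • (x - r)) (Pi.single i 1) := by
    intro t
    have hv : x - r = ∑ i, (x i - r i) • (Pi.single i (1 : ℝ) : Fin n → ℝ) :=
      pi_eq_sum_univ' (x - r)
    calc fderiv ℝ h (r + t • (x - r)) (x - r)
        = fderiv ℝ h (r + t • (x - r)) (∑ i, (x i - r i) • (Pi.single i (1 : ℝ) : Fin n → ℝ)) := by
          rw [← hv]
      _ = _ := by simp [map_sum]
  simp_rw [this] at key
  rw [intervalIntegral.integral_finsetSum
    (fun i _ => ((hcont _).const_mul _).intervalIntegrable _ _)] at key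
  simp only [intervalIntegral.integral_const_mul] at key
  linarith

/-! ## Smooth functions and `C^∞`-algebras -/

/-- Smooth real functions on `ℝ^n`. -/
abbrev SmoothFn (n : ℕ) : Type := {h : (Fin n → ℝ) → ℝ // ContDiff ℝ ∞ h}

namespace SmoothFn

/-- The `i`-th coordinate function on `ℝ^n`. -/
def proj {n : ℕ} (i : Fin n) : SmoothFn n := ⟨fun x => x i, contDiff_apply ℝ ℝ i⟩

/-- The composite function `x ↦ h (g₁ x, …, gₘ x)`. -/
def comp {n m : ℕ} (h : SmoothFn m) (g : Fin m → SmoothFn n) : SmoothFn n :=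
  ⟨fun x => h.1 (fun i => (g i).1 x), h.2.comp (contDiff_pi.2 fun i => (g i).2)⟩

def const (n : ℕ) (r : ℝ) : SmoothFn n := ⟨fun _ => r, contDiff_const⟩

def add2 : SmoothFn 2 := ⟨fun x => x 0 + x 1, (contDiff_apply ℝ ℝ 0).add (contDiff_apply ℝ ℝ 1)⟩

def mul2 : SmoothFn 2 := ⟨fun x => x 0 * x 1, (contDiff_apply ℝ ℝ 0).mul (contDiff_apply ℝ ℝ 1)⟩

def neg1 : SmoothFn 1 := ⟨fun x => - x 0, (contDiff_apply ℝ ℝ 0).neg⟩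

end SmoothFn

/-- A `C^∞`-algebra (`C^∞`-ring): a set on which every smooth function `ℝ^n → ℝ` acts as an
`n`-ary operation, compatibly with coordinate functions and composition. -/
structure CInfAlg where
  carrier : Type
  op : ∀ {n : ℕ}, SmoothFn n → (Fin n → carrier) → carrier
  op_proj : ∀ {n : ℕ} (i : Fin n) (a : Fin n → carrier), op (SmoothFn.proj i) a = a i
  op_comp : ∀ {n m : ℕ} (h : SmoothFn m) (g : Fin m → SmoothFn n) (a : Fin n → carrier),
    op (h.comp g) a = op h (fun i => op (g i) a)

namespace CInfAlg

instance : CoeSort CInfAlg Type := ⟨CInfAlg.carrier⟩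

section Ring

variable (A : CInfAlg)

instance : Zero A := ⟨A.op (SmoothFn.const 0 0) Fin.elim0⟩
instance : One A := ⟨A.op (SmoothFn.const 0 1) Fin.elim0⟩
instance : Add A := ⟨fun a b => A.op SmoothFn.add2 ![a, b]⟩
instance : Mul A := ⟨fun a b => A.op SmoothFn.mul2 ![a, b]⟩
instance : Neg A := ⟨fun a => A.op SmoothFn.neg1 ![a]⟩

variable {A}

theorem op_congr {n : ℕ} {h g : SmoothFn n} (a : Fin n → A) (e : ∀ x, h.1 x = g.1 x) :
    A.op h a = A.op g a := by
  rw [show h = g from Subtype.ext (funext e)]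

theorem const_eq {n : ℕ} (r : ℝ) (a : Fin n → A) :
    A.op (SmoothFn.const 0 r) Fin.elim0 = A.op (SmoothFn.const n r) a := by
  have := A.op_comp (SmoothFn.const 0 r) (Fin.elim0 : Fin 0 → SmoothFn n) a
  rw [show (fun i : Fin 0 => A.op ((Fin.elim0 : Fin 0 → SmoothFn n) i) a) = Fin.elim0 from
    funext fun i => i.elim0] at this
  rw [← this]
  rfl

theorem op_add {n : ℕ} (h g : SmoothFn n) (a : Fin n → A) :
    A.op h a + A.op g a = A.op (⟨fun x => h.1 x + g.1 x, h.2.add g.2⟩ : SmoothFn n) a := by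
  have := A.op_comp SmoothFn.add2 ![h, g] a
  rw [show (fun i => A.op (![h, g] i) a) = ![A.op h a, A.op g a] from
    funext fun i => by fin_cases i <;> rfl] at this
  exact this.symm

theorem op_mul {n : ℕ} (h g : SmoothFn n) (a : Fin n → A) :
    A.op h a * A.op g a = A.op (⟨fun x => h.1 x * g.1 x, h.2.mul g.2⟩ : SmoothFn n) a := by
  have := A.op_comp SmoothFn.mul2 ![h, g] a
  rw [show (fun i => A.op (![h, g] i) a) = ![A.op h a, A.op g a] from
    funext fun i => by fin_cases i <;> rfl] at this
  exact this.symm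

theorem op_neg {n : ℕ} (h : SmoothFn n) (a : Fin n → A) :
    - A.op h a = A.op (⟨fun x => - h.1 x, h.2.neg⟩ : SmoothFn n) a := by
  have := A.op_comp SmoothFn.neg1 ![h] a
  rw [show (fun i => A.op (![h] i) a) = ![A.op h a] from
    funext fun i => by fin_cases i; rfl] at this
  exact this.symm

theorem zero_eq {n : ℕ} (a : Fin n → A) : (0 : A) = A.op (SmoothFn.const n 0) a := const_eq 0 a

theorem one_eq {n : ℕ} (a : Fin n → A) : (1 : A) = A.op (SmoothFn.const n 1) a := const_eq 1 a

/-- The ring structure underlying a `C^∞`-algebra: sums and products are given by the smooth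
functions `x₀ + x₁` and `x₀ * x₁`. -/
instance : CommRing A where
  add_assoc a b c := by
    let v : Fin 3 → A := ![a, b, c]
    have ha : A.op (SmoothFn.proj 0) v = a := A.op_proj 0 v
    have hb : A.op (SmoothFn.proj 1) v = b := A.op_proj 1 v
    have hc : A.op (SmoothFn.proj 2) v = c := A.op_proj 2 v
    rw [← ha, ← hb, ← hc]
    simp only [op_add]
    exact op_congr _ fun x => add_assoc _ _ _
  zero_add a := by
    let v : Fin 1 → A := ![a]
    have ha : A.op (SmoothFn.proj 0) v = a := A.op_proj 0 v
    rw [← ha, zero_eq v, op_add]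
    exact op_congr _ fun x => zero_add _
  add_zero a := by
    let v : Fin 1 → A := ![a]
    have ha : A.op (SmoothFn.proj 0) v = a := A.op_proj 0 v
    rw [← ha, zero_eq v, op_add]
    exact op_congr _ fun x => add_zero _
  add_comm a b := by
    let v : Fin 2 → A := ![a, b]
    have ha : A.op (SmoothFn.proj 0) v = a := A.op_proj 0 v
    have hb : A.op (SmoothFn.proj 1) v = b := A.op_proj 1 v
    rw [← ha, ← hb]
    simp only [op_add]
    exact op_congr _ fun x => add_comm _ _
  left_distrib a b c := by
    let v : Fin 3 → A := ![a, b, c]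
    have ha : A.op (SmoothFn.proj 0) v = a := A.op_proj 0 v
    have hb : A.op (SmoothFn.proj 1) v = b := A.op_proj 1 v
    have hc : A.op (SmoothFn.proj 2) v = c := A.op_proj 2 v
    rw [← ha, ← hb, ← hc]
    simp only [op_add, op_mul]
    exact op_congr _ fun x => left_distrib _ _ _
  right_distrib a b c := by
    let v : Fin 3 → A := ![a, b, c]
    have ha : A.op (SmoothFn.proj 0) v = a := A.op_proj 0 v
    have hb : A.op (SmoothFn.proj 1) v = b := A.op_proj 1 v
    have hc : A.op (SmoothFn.proj 2) v = c := A.op_proj 2 v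
    rw [← ha, ← hb, ← hc]
    simp only [op_add, op_mul]
    exact op_congr _ fun x => right_distrib _ _ _
  zero_mul a := by
    let v : Fin 1 → A := ![a]
    have ha : A.op (SmoothFn.proj 0) v = a := A.op_proj 0 v
    rw [← ha, zero_eq v, op_mul]
    exact op_congr _ fun x => zero_mul _
  mul_zero a := by
    let v : Fin 1 → A := ![a]
    have ha : A.op (SmoothFn.proj 0) v = a := A.op_proj 0 v
    rw [← ha, zero_eq v, op_mul]
    exact op_congr _ fun x => mul_zero _
  mul_assoc a b c := by
    let v : Fin 3 → A := ![a, b, c]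
    have ha : A.op (SmoothFn.proj 0) v = a := A.op_proj 0 v
    have hb : A.op (SmoothFn.proj 1) v = b := A.op_proj 1 v
    have hc : A.op (SmoothFn.proj 2) v = c := A.op_proj 2 v
    rw [← ha, ← hb, ← hc]
    simp only [op_mul]
    exact op_congr _ fun x => mul_assoc _ _ _
  one_mul a := by
    let v : Fin 1 → A := ![a]
    have ha : A.op (SmoothFn.proj 0) v = a := A.op_proj 0 v
    rw [← ha, one_eq v, op_mul]
    exact op_congr _ fun x => one_mul _
  mul_one a := by
    let v : Fin 1 → A := ![a]
    have ha : A.op (SmoothFn.proj 0) v = a := A.op_proj 0 v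
    rw [← ha, one_eq v, op_mul]
    exact op_congr _ fun x => mul_one _
  mul_comm a b := by
    let v : Fin 2 → A := ![a, b]
    have ha : A.op (SmoothFn.proj 0) v = a := A.op_proj 0 v
    have hb : A.op (SmoothFn.proj 1) v = b := A.op_proj 1 v
    rw [← ha, ← hb]
    simp only [op_mul]
    exact op_congr _ fun x => mul_comm _ _
  neg_add_cancel a := by
    let v : Fin 1 → A := ![a]
    have ha : A.op (SmoothFn.proj 0) v = a := A.op_proj 0 v
    rw [← ha, zero_eq v, op_neg, op_add]
    exact op_congr _ fun x => neg_add_cancel _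
  nsmul := nsmulRec
  zsmul := zsmulRec

/-- Real scalars act through the constant functions. -/
instance : Algebra ℝ A :=
  RingHom.toAlgebra
    { toFun := fun r => A.op (SmoothFn.const 0 r) Fin.elim0
      map_one' := rfl
      map_zero' := rfl
      map_add' := fun r s => (op_add (SmoothFn.const 0 r) (SmoothFn.const 0 s) _).symm
      map_mul' := fun r s => (op_mul (SmoothFn.const 0 r) (SmoothFn.const 0 s) _).symm }

theorem algebraMap_eq {n : ℕ} (r : ℝ) (a : Fin n → A) :
    algebraMap ℝ A r = A.op (SmoothFn.const n r) a := const_eq r a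

end Ring

/-- Homomorphisms of `C^∞`-algebras: maps that commute with all smooth operations. -/
@[ext]
structure Hom (A B : CInfAlg) where
  toFun : A → B
  map_op : ∀ {n : ℕ} (h : SmoothFn n) (a : Fin n → A), toFun (A.op h a) = B.op h (toFun ∘ a)

/-- The category of `C^∞`-algebras. -/
instance : Category CInfAlg where
  Hom := Hom
  id A := ⟨id, fun _ _ => rfl⟩
  comp f g := ⟨g.toFun ∘ f.toFun, fun h a => by
    simp only [Function.comp_apply, f.map_op, g.map_op]; rfl⟩

@[ext]
theorem hom_ext {A B : CInfAlg} {f g : A ⟶ B} (h : ∀ a, f.toFun a = g.toFun a) : f = g :=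
  Hom.ext (funext h)

@[simp] theorem id_toFun (A : CInfAlg) (a : A) : Hom.toFun (𝟙 A) a = a := rfl

@[simp] theorem comp_toFun {A B C : CInfAlg} (f : A ⟶ B) (g : B ⟶ C) (a : A) :
    (f ≫ g).toFun a = g.toFun (f.toFun a) := rfl

/-- A homomorphism of `C^∞`-algebras is a homomorphism of the underlying `ℝ`-algebras. -/
def Hom.toAlgHom {A B : CInfAlg} (f : A ⟶ B) : A →ₐ[ℝ] B where
  toFun := f.toFun
  map_one' := by
    refine (f.map_op _ _).trans ?_
    exact congrArg (B.op _) (funext fun i => i.elim0)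
  map_zero' := by
    refine (f.map_op _ _).trans ?_
    exact congrArg (B.op _) (funext fun i => i.elim0)
  map_add' a b := by
    refine (f.map_op _ _).trans ?_
    exact congrArg (B.op _) (funext fun i => by fin_cases i <;> rfl)
  map_mul' a b := by
    refine (f.map_op _ _).trans ?_
    exact congrArg (B.op _) (funext fun i => by fin_cases i <;> rfl)
  commutes' r := by
    refine (f.map_op _ _).trans ?_
    exact congrArg (B.op _) (funext fun i => i.elim0)

/-- The `C^∞`-algebra `C^∞(ℝ^n)`. -/
def free (n : ℕ) : CInfAlg where
  carrier := SmoothFn n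
  op h g := h.comp g
  op_proj _ _ := rfl
  op_comp _ _ _ := rfl

/-- The `C^∞`-algebra `ℝ`. -/
def real : CInfAlg where
  carrier := ℝ
  op h a := h.1 a
  op_proj _ _ := rfl
  op_comp _ _ _ := rfl

/-- A homomorphism of `C^∞`-algebras with values in `ℝ`, as an algebra homomorphism. -/
def toReal {A : CInfAlg} (f : A ⟶ real) : A →ₐ[ℝ] ℝ where
  toFun := f.toFun
  map_one' := f.map_op _ _
  map_zero' := f.map_op _ _
  map_add' _ _ := f.map_op _ _
  map_mul' _ _ := f.map_op _ _
  commutes' _ := f.map_op _ _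

/-! ### The tensor product `A ⊗_∞ B`, i.e. the coproduct of `C^∞`-algebras -/

/-- Formal smooth expressions in elements of `A` and `B`. -/
inductive Term (A B : CInfAlg) : Type
  | inl : A → Term A B
  | inr : B → Term A B
  | op : ∀ {n : ℕ}, SmoothFn n → (Fin n → Term A B) → Term A B

/-- The smallest congruence making the formal expressions a `C^∞`-algebra that receives
homomorphisms from `A` and from `B`. -/
inductive Term.Rel (A B : CInfAlg) : Term A B → Term A B → Prop
  | refl (s) : Rel A B s s
  | symm {s t} : Rel A B s t → Rel A B t s
  | trans {s t u} : Rel A B s t → Rel A B t u → Rel A B s u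
  | op {n : ℕ} (h : SmoothFn n) (s t : Fin n → Term A B) :
      (∀ i, Rel A B (s i) (t i)) → Rel A B (.op h s) (.op h t)
  | proj {n : ℕ} (i : Fin n) (s : Fin n → Term A B) : Rel A B (.op (SmoothFn.proj i) s) (s i)
  | comp {n m : ℕ} (h : SmoothFn m) (g : Fin m → SmoothFn n) (s : Fin n → Term A B) :
      Rel A B (.op (h.comp g) s) (.op h fun i => .op (g i) s)
  | inl {n : ℕ} (h : SmoothFn n) (a : Fin n → A) :
      Rel A B (.inl (A.op h a)) (.op h fun i => .inl (a i))
  | inr {n : ℕ} (h : SmoothFn n) (b : Fin n → B) :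
      Rel A B (.inr (B.op h b)) (.op h fun i => .inr (b i))

instance Term.setoid (A B : CInfAlg) : Setoid (Term A B) where
  r := Term.Rel A B
  iseqv := ⟨.refl, .symm, .trans⟩

/-- The tensor product `A ⊗_∞ B` of `C^∞`-algebras. -/
def tensor (A B : CInfAlg) : CInfAlg where
  carrier := Quotient (Term.setoid A B)
  op h a := Quotient.mk _ (Term.op h fun i => (a i).out)
  op_proj i a := (Quotient.sound (Term.Rel.proj i _)).trans (Quotient.out_eq (a i))
  op_comp h g a := Quotient.sound <| (Term.Rel.comp h g _).trans <|
    .op _ _ _ fun i => .symm (Quotient.mk_out (s := Term.setoid A B) _)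

theorem tensor_op_mk {A B : CInfAlg} {n : ℕ} (h : SmoothFn n) (s : Fin n → Term A B) :
    (tensor A B).op h (fun i => Quotient.mk _ (s i)) = Quotient.mk _ (Term.op h s) :=
  Quotient.sound <| .op _ _ _ fun i => Quotient.mk_out (s := Term.setoid A B) _

/-- The first coproduct inclusion. -/
def tensorInl (A B : CInfAlg) : A ⟶ tensor A B where
  toFun a := Quotient.mk _ (.inl a)
  map_op h a := (Quotient.sound (Term.Rel.inl h a)).trans (tensor_op_mk h _).symm

/-- The second coproduct inclusion. -/
def tensorInr (A B : CInfAlg) : B ⟶ tensor A B where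
  toFun b := Quotient.mk _ (.inr b)
  map_op h b := (Quotient.sound (Term.Rel.inr h b)).trans (tensor_op_mk h _).symm

def Term.eval {A B C : CInfAlg} (f : A ⟶ C) (g : B ⟶ C) : Term A B → C
  | .inl a => f.toFun a
  | .inr b => g.toFun b
  | .op h s => C.op h fun i => (s i).eval f g

theorem Term.eval_rel {A B C : CInfAlg} (f : A ⟶ C) (g : B ⟶ C) {s t : Term A B}
    (r : Term.Rel A B s t) : s.eval f g = t.eval f g := by
  induction r with
  | refl _ => rfl
  | symm _ ih => exact ih.symm
  | trans _ _ ih₁ ih₂ => exact ih₁.trans ih₂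
  | op h _ _ _ ih => exact congrArg (C.op h) (funext ih)
  | proj i _ => exact C.op_proj i _
  | comp h k _ => exact C.op_comp h k _
  | inl h a => exact f.map_op h a
  | inr h b => exact g.map_op h b

/-- The homomorphism `A ⊗_∞ B ⟶ C` with given restrictions to `A` and `B`. -/
def tensorDesc {A B C : CInfAlg} (f : A ⟶ C) (g : B ⟶ C) : tensor A B ⟶ C where
  toFun := Quotient.lift (Term.eval f g) fun _ _ r => Term.eval_rel f g r
  map_op {n} h a := by
    obtain ⟨s, rfl⟩ : ∃ s : Fin n → Term A B, a = fun i => Quotient.mk _ (s i) :=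
      ⟨fun i => (a i).out, funext fun i => (Quotient.out_eq (a i)).symm⟩
    rw [tensor_op_mk]
    rfl

theorem tensor_induction {A B : CInfAlg} {p : tensor A B → Prop}
    (hl : ∀ a, p ((tensorInl A B).toFun a)) (hr : ∀ b, p ((tensorInr A B).toFun b))
    (hop : ∀ {n : ℕ} (h : SmoothFn n) (x : Fin n → tensor A B), (∀ i, p (x i)) →
      p ((tensor A B).op h x)) (x : tensor A B) : p x := by
  induction x using Quotient.ind with
  | _ s =>
    induction s with
    | inl a => exact hl a
    | inr b => exact hr b
    | op h s ih =>
      have := hop h _ ih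
      rwa [tensor_op_mk] at this

theorem tensor_hom_ext {A B C : CInfAlg} {f g : tensor A B ⟶ C}
    (hl : tensorInl A B ≫ f = tensorInl A B ≫ g)
    (hr : tensorInr A B ≫ f = tensorInr A B ≫ g) : f = g := by
  ext x
  induction x using tensor_induction with
  | hl a => exact congrFun (congrArg Hom.toFun hl) a
  | hr b => exact congrFun (congrArg Hom.toFun hr) b
  | hop h x ih =>
    rw [f.map_op, g.map_op]
    exact congrArg _ (funext ih)

@[simp] theorem tensorInl_desc {A B C : CInfAlg} (f : A ⟶ C) (g : B ⟶ C) :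
    tensorInl A B ≫ tensorDesc f g = f := rfl

@[simp] theorem tensorInr_desc {A B C : CInfAlg} (f : A ⟶ C) (g : B ⟶ C) :
    tensorInr A B ≫ tensorDesc f g = g := rfl

/-- `A ⊗_∞ B` is the coproduct of `A` and `B` in the category of `C^∞`-algebras. -/
def tensorIsColimit (A B : CInfAlg) :
    IsColimit (BinaryCofan.mk (tensorInl A B) (tensorInr A B)) :=
  BinaryCofan.IsColimit.mk _ (fun f g => tensorDesc f g) (fun _ _ => rfl) (fun _ _ => rfl)
    fun _ _ _ h₁ h₂ => tensor_hom_ext h₁ h₂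

/-- Functoriality of `⊗_∞`. -/
def tensorMap {A A' B B' : CInfAlg} (f : A ⟶ A') (g : B ⟶ B') : tensor A B ⟶ tensor A' B' :=
  tensorDesc (f ≫ tensorInl A' B') (g ≫ tensorInr A' B')

@[simp] theorem tensorMap_id (A B : CInfAlg) : tensorMap (𝟙 A) (𝟙 B) = 𝟙 (tensor A B) :=
  tensor_hom_ext rfl rfl

theorem tensorMap_comp {A A' A'' B B' B'' : CInfAlg} (f : A ⟶ A') (f' : A' ⟶ A'')
    (g : B ⟶ B') (g' : B' ⟶ B'') :
    tensorMap (f ≫ f') (g ≫ g') = tensorMap f g ≫ tensorMap f' g' :=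
  tensor_hom_ext rfl rfl


theorem op_sum {A : CInfAlg} {n : ℕ} {ι : Type} (s : Finset ι) (g : ι → SmoothFn n)
    (a : Fin n → A) :
    ∑ i ∈ s, A.op (g i) a =
      A.op (⟨fun x => ∑ i ∈ s, (g i).1 x, ContDiff.sum fun i _ => (g i).2⟩ : SmoothFn n) a := by
  classical
  induction s using Finset.induction_on with
  | empty =>
    rw [Finset.sum_empty, zero_eq a]
    exact op_congr _ fun x => by simp [SmoothFn.const]
  | insert i s hi ih =>
    rw [Finset.sum_insert hi, ih, op_add]
    exact op_congr _ fun x => by simp [Finset.sum_insert hi]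

theorem op_hadamard {A : CInfAlg} {n : ℕ} (h : SmoothFn n) (r : Fin n → ℝ) :
    ∃ g : Fin n → SmoothFn n, ∀ a : Fin n → A, A.op h a =
      algebraMap ℝ A (h.1 r) + ∑ i, (a i - algebraMap ℝ A (r i)) * A.op (g i) a := by
  obtain ⟨g, hg, e⟩ := hadamard h.1 h.2 r
  refine ⟨fun i => ⟨g i, hg i⟩, fun a => ?_⟩
  have h1 : ∀ i, (a i - algebraMap ℝ A (r i)) * A.op (⟨g i, hg i⟩ : SmoothFn n) a =
      A.op (⟨fun x => (x i + - r i) * g i x,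
        ((contDiff_apply ℝ ℝ i).add contDiff_const).mul (hg i)⟩ : SmoothFn n) a := by
    intro i
    conv_lhs => rw [← A.op_proj i a]
    rw [sub_eq_add_neg, algebraMap_eq _ a, op_neg, op_add, op_mul]
    rfl
  simp_rw [h1]
  rw [op_sum, algebraMap_eq _ a, op_add]
  exact op_congr _ fun x => by
    rw [e x]
    simp [SmoothFn.const, sub_eq_add_neg]

end CInfAlg

/-! ## Weil algebras -/

/-- Weil algebras: finite-dimensional commutative real algebras of the form `W = ℝ ⊕ N` where all
elements of the ideal `N` are nilpotent. -/
def IsWeilAlgebra (W : Type) [CommRing W] [Algebra ℝ W] : Prop :=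
  Module.Finite ℝ W ∧ ∃ ε : W →ₐ[ℝ] ℝ, ∀ w, ε w = 0 → IsNilpotent w

/-- `C^∞`-algebras whose underlying real algebra is a Weil algebra. Every Weil algebra has exactly
one structure of a `C^∞`-algebra, and the algebra homomorphisms between Weil algebras are
precisely the homomorphisms of `C^∞`-algebras. -/
def isWeil : ObjectProperty CInfAlg := fun W => IsWeilAlgebra W

/-- The category `𝐖` of Weil algebras. -/
abbrev WeilAlg := isWeil.FullSubcategory

/-- The inclusion of Weil algebras in `C^∞`-algebras. -/
abbrev WeilAlg.incl : WeilAlg ⥤ CInfAlg := isWeil.ι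

/-- The unique homomorphism `W → ℝ` (its kernel is the maximal ideal). -/
def WeilAlg.aug (W : WeilAlg) : W.obj →ₐ[ℝ] ℝ := W.property.2.choose

theorem WeilAlg.aug_nilpotent (W : WeilAlg) (w : W.obj) (h : W.aug w = 0) : IsNilpotent w :=
  W.property.2.choose_spec w h

theorem WeilAlg.nilpotent_sub (W : WeilAlg) (w : W.obj) :
    IsNilpotent (w - algebraMap ℝ W.obj (W.aug w)) :=
  W.aug_nilpotent _ (by rw [map_sub, AlgHom.commutes]; simp)

theorem aug_map {W W' : WeilAlg} (φ : W ⟶ W') (w : W.obj) :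
    W'.aug (φ.hom.toFun w) = W.aug w := by
  have h1 := ((W.nilpotent_sub w).map φ.hom.toAlgHom).map W'.aug
  rw [map_sub, AlgHom.commutes, map_sub, AlgHom.commutes] at h1
  exact sub_eq_zero.1 h1.eq_zero

theorem aug_op (W : WeilAlg) {n : ℕ} (h : SmoothFn n) (w : Fin n → W.obj) :
    W.aug (W.obj.op h w) = h.1 fun i => W.aug (w i) := by
  obtain ⟨g, hg⟩ := CInfAlg.op_hadamard (A := W.obj) h fun i => W.aug (w i)
  rw [hg]
  simp

/-- The augmentation as a homomorphism of `C^∞`-algebras. -/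
def WeilAlg.augHom (W : WeilAlg) : W.obj ⟶ CInfAlg.real where
  toFun := W.aug
  map_op h a := aug_op W h a

/-- The class of Weil algebras is closed under `⊗_∞`. -/
theorem isWeil_tensor (W₁ W₂ : WeilAlg) : isWeil (CInfAlg.tensor W₁.obj W₂.obj) := by
  let T := CInfAlg.tensor W₁.obj W₂.obj
  let i₁ : W₁.obj →ₐ[ℝ] T := (CInfAlg.tensorInl W₁.obj W₂.obj).toAlgHom
  let i₂ : W₂.obj →ₐ[ℝ] T := (CInfAlg.tensorInr W₁.obj W₂.obj).toAlgHom
  let m : TensorProduct ℝ W₁.obj W₂.obj →ₐ[ℝ] T :=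
    Algebra.TensorProduct.lift i₁ i₂ fun _ _ => Commute.all _ _
  have hnil : ∀ x : T, x ∈ m.range → ∃ r : ℝ, IsNilpotent (x - algebraMap ℝ T r) := by
    rintro _ ⟨y, rfl⟩
    induction y using TensorProduct.induction_on with
    | zero => exact ⟨0, by simp⟩
    | tmul a b =>
      refine ⟨W₁.aug a * W₂.aug b, ?_⟩
      have e : m (a ⊗ₜ b) - algebraMap ℝ T (W₁.aug a * W₂.aug b) =
          i₁ (a - algebraMap ℝ _ (W₁.aug a)) * i₂ b +
            algebraMap ℝ T (W₁.aug a) * i₂ (b - algebraMap ℝ _ (W₂.aug b)) := by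
        have : m (a ⊗ₜ b) = i₁ a * i₂ b := Algebra.TensorProduct.lift_tmul _ _ _ _ _
        rw [this, map_sub, map_sub, AlgHom.commutes, AlgHom.commutes, map_mul]
        ring
      have e' : (m.toRingHom (a ⊗ₜ b)) = m (a ⊗ₜ b) := rfl
      rw [e', e]
      exact Commute.isNilpotent_add (Commute.all _ _)
        (Commute.isNilpotent_mul_right (Commute.all _ _) ((W₁.nilpotent_sub a).map i₁))
        (Commute.isNilpotent_mul_left (Commute.all _ _) ((W₂.nilpotent_sub b).map i₂))
    | add x y hx hy =>
      obtain ⟨r, hr⟩ := hx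
      obtain ⟨s, hs⟩ := hy
      refine ⟨r + s, ?_⟩
      have e : m.toRingHom (x + y) - algebraMap ℝ T (r + s) =
          (m.toRingHom x - algebraMap ℝ T r) + (m.toRingHom y - algebraMap ℝ T s) := by
        rw [map_add, map_add]
        ring
      rw [e]
      exact Commute.isNilpotent_add (Commute.all _ _) hr hs
  have hop : ∀ {n : ℕ} (h : SmoothFn n) (x : Fin n → T), (∀ i, x i ∈ m.range) →
      T.op h x ∈ m.range := by
    intro n h x hx
    choose r hr using fun i => hnil (x i) (hx i)
    let N : Ideal T := Ideal.span (Set.range fun i => x i - algebraMap ℝ T (r i))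
    have hN : IsNilpotent N := by
      rw [Ideal.FG.isNilpotent_iff_le_nilradical
        ⟨(Set.finite_range fun i => x i - algebraMap ℝ T (r i)).toFinset, by simp [N]⟩]
      refine Ideal.span_le.2 ?_
      rintro _ ⟨i, rfl⟩
      exact hr i
    have step : ∀ (j : ℕ) (h : SmoothFn n), ∃ y ∈ m.range, T.op h x - y ∈ N ^ j := by
      intro j
      induction j with
      | zero => exact fun h => ⟨0, zero_mem _, by simp⟩
      | succ j ih =>
        intro h
        obtain ⟨g, hg⟩ := CInfAlg.op_hadamard (A := T) h r
        choose y hy hy' using fun i => ih (g i)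
        refine ⟨algebraMap ℝ T (h.1 r) + ∑ i, (x i - algebraMap ℝ T (r i)) * y i,
          add_mem (Subalgebra.algebraMap_mem _ _) (sum_mem fun i _ => mul_mem
            (sub_mem (hx i) (Subalgebra.algebraMap_mem _ _)) (hy i)), ?_⟩
        rw [hg x, add_sub_add_left_eq_sub, ← Finset.sum_sub_distrib]
        refine sum_mem fun i _ => ?_
        rw [← mul_sub, pow_succ']
        exact Ideal.mul_mem_mul (Ideal.subset_span ⟨i, rfl⟩) (hy' i)
    obtain ⟨k, hk⟩ := hN
    obtain ⟨y, hy, hy'⟩ := step k h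
    rw [hk] at hy'
    rw [sub_eq_zero.1 hy']
    exact hy
  have hall : ∀ x : T, x ∈ m.range := fun x =>
    CInfAlg.tensor_induction
      (fun a => ⟨a ⊗ₜ 1, (Algebra.TensorProduct.lift_tmul _ _ _ _ _).trans (by simp; rfl)⟩)
      (fun b => ⟨1 ⊗ₜ b, (Algebra.TensorProduct.lift_tmul _ _ _ _ _).trans (by simp; rfl)⟩)
      hop x
  have := W₁.property.1
  have := W₂.property.1
  refine ⟨Module.Finite.of_surjective m.toLinearMap hall, ?_⟩
  let ε : T →ₐ[ℝ] ℝ := CInfAlg.toReal (CInfAlg.tensorDesc W₁.augHom W₂.augHom)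
  refine ⟨ε, fun x hx => ?_⟩
  obtain ⟨r, hr⟩ := hnil x (hall x)
  have h1 := (hr.map ε).eq_zero
  rw [map_sub, hx, AlgHom.commutes] at h1
  have : r = 0 := by simpa using h1
  simpa [this] using hr

/-- The tensor product `W₁ ⊗_∞ W₂` of Weil algebras. -/
def WeilAlg.tensor (W₁ W₂ : WeilAlg) : WeilAlg := ⟨CInfAlg.tensor W₁.obj W₂.obj, isWeil_tensor W₁ W₂⟩

/-- Functoriality of the tensor product of Weil algebras. -/
def WeilAlg.tensorMap {W₁ W₁' W₂ W₂' : WeilAlg} (φ₁ : W₁ ⟶ W₁') (φ₂ : W₂ ⟶ W₂') :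
    W₁.tensor W₂ ⟶ W₁'.tensor W₂' :=
  ObjectProperty.homMk (CInfAlg.tensorMap φ₁.hom φ₂.hom)

/-- A cone over a diagram of Weil algebras is a limit diagram of Weil algebras if it is a limit
cone of `C^∞`-algebras (equivalently, of real algebras). For connected diagrams this is the same
as a limit cone in the category of Weil algebras. -/
def IsWeilLimit {J : Type} [SmallCategory J] {F : J ⥤ WeilAlg} (c : Cone F) : Prop :=
  Nonempty (IsLimit (WeilAlg.incl.mapCone c))

/-! ## Frölicher spaces -/

/-- A Frölicher space: a set with a set of curves and a set of real functions that determine each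
other by the condition that `f ∘ c` is smooth. -/
structure Frol where
  carrier : Type
  curves : Set (ℝ → carrier)
  functions : Set (carrier → ℝ)
  mem_curves : ∀ c, c ∈ curves ↔ ∀ f ∈ functions, ContDiff ℝ ∞ (f ∘ c)
  mem_functions : ∀ f, f ∈ functions ↔ ∀ c ∈ curves, ContDiff ℝ ∞ (f ∘ c)

namespace Frol

instance : CoeSort Frol Type := ⟨Frol.carrier⟩

/-- Smooth mappings of Frölicher spaces. -/
@[ext]
structure Hom (X Y : Frol) where
  toFun : X → Y
  smooth : ∀ c ∈ X.curves, toFun ∘ c ∈ Y.curves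

/-- The category `𝐅𝐒` of Frölicher spaces and smooth mappings. -/
instance : Category Frol where
  Hom := Hom
  id X := ⟨id, fun _ h => h⟩
  comp f g := ⟨g.toFun ∘ f.toFun, fun c h => g.smooth _ (f.smooth c h)⟩

@[ext]
theorem hom_ext {X Y : Frol} {f g : X ⟶ Y} (h : ∀ x, f.toFun x = g.toFun x) : f = g :=
  Hom.ext (funext h)

@[simp] theorem id_toFun (X : Frol) (x : X) : Hom.toFun (𝟙 X) x = x := rfl

@[simp] theorem comp_toFun {X Y Z : Frol} (f : X ⟶ Y) (g : Y ⟶ Z) (x : X) :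
    (f ≫ g).toFun x = g.toFun (f.toFun x) := rfl

theorem comp_mem_functions {X Y : Frol} (φ : X ⟶ Y) {χ : Y → ℝ} (h : χ ∈ Y.functions) :
    χ ∘ φ.toFun ∈ X.functions :=
  (X.mem_functions _).2 fun c hc => (Y.mem_functions χ).1 h _ (φ.smooth c hc)

/-- The underlying-set functor. -/
def forget : Frol ⥤ Type where
  obj X := X
  map f := ↾f.toFun

/-- The Frölicher space on a set `S` generated by a set of curves. -/
def generate (S : Type) (C : Set (ℝ → S)) : Frol where
  carrier := S
  functions := {f | ∀ c ∈ C, ContDiff ℝ ∞ (f ∘ c)}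
  curves := {c | ∀ f : S → ℝ, (∀ c ∈ C, ContDiff ℝ ∞ (f ∘ c)) → ContDiff ℝ ∞ (f ∘ c)}
  mem_curves _ := Iff.rfl
  mem_functions f := ⟨fun hf _ hc => hc f hf, fun hf c hc => hf c fun _ hg => hg c hc⟩

/-- A map on a generated Frölicher space is smooth as soon as it maps the generating curves to
smooth curves. -/
def generateDesc {S : Type} {C : Set (ℝ → S)} {Y : Frol} (φ : S → Y)
    (h : ∀ c ∈ C, φ ∘ c ∈ Y.curves) : generate S C ⟶ Y where
  toFun := φ
  smooth c hc := (Y.mem_curves _).2 fun f hf =>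
    hc (f ∘ φ) fun c' hc' => (Y.mem_curves _).1 (h c' hc') f hf

theorem mem_generate {S : Type} {C : Set (ℝ → S)} {c : ℝ → S} (h : c ∈ C) :
    c ∈ (generate S C).curves := fun _ hf => hf c h

/-- `ℝ^n` with its smooth curves. -/
def euclidean (n : ℕ) : Frol where
  carrier := Fin n → ℝ
  curves := {c | ContDiff ℝ ∞ c}
  functions := {f | ∀ c : ℝ → Fin n → ℝ, ContDiff ℝ ∞ c → ContDiff ℝ ∞ (f ∘ c)}
  mem_curves c := ⟨fun hc f hf => hf c hc, fun h => contDiff_pi.2 fun i =>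
    h (fun x => x i) fun c' hc' => (contDiff_apply ℝ ℝ i).comp hc'⟩
  mem_functions _ := Iff.rfl

/-- The exponential `X^Y`: the set of smooth mappings `Y → X` with the Frölicher structure
generated by the curves `c` whose adjoint `ℝ × Y → X` is smooth. -/
def exp (X Y : Frol) : Frol :=
  generate (Y ⟶ X)
    {c | ∀ s : ℝ → ℝ, ContDiff ℝ ∞ s → ∀ y ∈ Y.curves, (fun t => (c (s t)).toFun (y t)) ∈ X.curves}

/-- The map `X^Y ⟶ X'^Y'` given by `u ↦ g ≫ u ≫ f`. -/
def expMap {X X' Y Y' : Frol} (f : X ⟶ X') (g : Y' ⟶ Y) : exp X Y ⟶ exp X' Y' :=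
  generateDesc (Y := exp X' Y') (fun u => g ≫ u ≫ f) fun _ hc =>
    mem_generate fun s hs y hy => f.smooth _ (hc s hs _ (g.smooth y hy))

/-- Smoothness of a mapping from a Euclidean space `E` to a Frölicher space `X`: all smooth
functions on `X` pull back to smooth functions on `E`. By Boman's theorem, these are exactly the
mappings that carry smooth curves in `E` to smooth curves in `X`. -/
def IsSmooth {E : Type} [NormedAddCommGroup E] [NormedSpace ℝ E] {X : Frol} (f : E → X) : Prop :=
  ∀ χ ∈ X.functions, ContDiff ℝ ∞ (χ ∘ f)

theorem IsSmooth.map {E : Type} [NormedAddCommGroup E] [NormedSpace ℝ E] {X Y : Frol}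
    {f : E → X} (hf : IsSmooth f) (φ : X ⟶ Y) : IsSmooth (φ.toFun ∘ f) :=
  fun _ hχ => hf _ (comp_mem_functions φ hχ)

/-! ## Weil prolongation -/

/-- Representatives of the points of `X ⊗ W`: a smooth mapping `f : ℝ^k → X` together with a
`k`-tuple `w` in `W`, that is, a homomorphism `C^∞(ℝ^k) → W`, `h ↦ h(w)`. -/
structure Jet (X : Frol) (W : WeilAlg) where
  k : ℕ
  w : Fin k → W.obj
  f : (Fin k → ℝ) → X
  smooth : IsSmooth f

namespace Jet

variable {X : Frol} {W : WeilAlg}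

/-- The base point of a jet. -/
def base (j : Jet X W) : X := j.f fun i => W.aug (j.w i)

/-- The value in `W` of a smooth function on `X` at a jet. -/
def eval (j : Jet X W) (χ : X → ℝ) (h : χ ∈ X.functions) : W.obj :=
  W.obj.op (⟨χ ∘ j.f, j.smooth χ h⟩ : SmoothFn j.k) j.w

/-- Two jets are equivalent if they have the same base point and all smooth functions on `X` take
the same values at them. If `W = C^∞(ℝ^k)/I` and `w` consists of the classes of the coordinate
functions, `(w, f)` and `(w, g)` are equivalent if and only if `f` and `g` agree at the base point
of `W` and `χ ∘ f - χ ∘ g ∈ I` for all smooth `χ : X → ℝ`; and every jet is equivalent to one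
with this `w`. -/
instance setoid (X : Frol) (W : WeilAlg) : Setoid (Jet X W) where
  r j j' := j.base = j'.base ∧ ∀ χ h, j.eval χ h = j'.eval χ h
  iseqv := ⟨fun _ => ⟨rfl, fun _ _ => rfl⟩, fun h => ⟨h.1.symm, fun χ hχ => (h.2 χ hχ).symm⟩,
    fun h h' => ⟨h.1.trans h'.1, fun χ hχ => (h.2 χ hχ).trans (h'.2 χ hχ)⟩⟩

/-- Functoriality of jets. -/
def map {X' : Frol} {W' : WeilAlg} (f : X ⟶ X') (φ : W ⟶ W') (j : Jet X W) : Jet X' W' :=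
  ⟨j.k, φ.hom.toFun ∘ j.w, f.toFun ∘ j.f, j.smooth.map f⟩

theorem map_base {X' : Frol} {W' : WeilAlg} (f : X ⟶ X') (φ : W ⟶ W') (j : Jet X W) :
    (j.map f φ).base = f.toFun j.base :=
  congrArg (fun x => f.toFun (j.f x)) (funext fun i => aug_map φ (j.w i))

theorem map_eval {X' : Frol} {W' : WeilAlg} (f : X ⟶ X') (φ : W ⟶ W') (j : Jet X W)
    (χ : X' → ℝ) (h : χ ∈ X'.functions) :
    (j.map f φ).eval χ h = φ.hom.toFun (j.eval (χ ∘ f.toFun) (comp_mem_functions f h)) :=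
  (φ.hom.map_op _ _).symm

theorem map_rel {X' : Frol} {W' : WeilAlg} (f : X ⟶ X') (φ : W ⟶ W') {j j' : Jet X W}
    (h : j ≈ j') : j.map f φ ≈ j'.map f φ :=
  ⟨by rw [map_base, map_base, h.1], fun χ hχ => by rw [map_eval, map_eval, h.2]⟩

end Jet

/-- The Weil prolongation `X ⊗ W`: the set of equivalence classes of jets with the quotient
Frölicher structure, which is generated by the curves `t ↦ [w, F t]` for smooth
`F : ℝ × ℝ^k → X`. -/
def prolong (X : Frol) (W : WeilAlg) : Frol :=
  generate (Quotient (Jet.setoid X W))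
    {c | ∃ (k : ℕ) (w : Fin k → W.obj) (F : ℝ → (Fin k → ℝ) → X)
      (_ : IsSmooth fun p : ℝ × (Fin k → ℝ) => F p.1 p.2) (hF : ∀ t, IsSmooth (F t)),
      c = fun t => Quotient.mk _ ⟨k, w, F t, hF t⟩}

/-- The map `f ⊗ φ : X ⊗ W ⟶ X' ⊗ W'`. -/
def prolongMap {X X' : Frol} {W W' : WeilAlg} (f : X ⟶ X') (φ : W ⟶ W') :
    prolong X W ⟶ prolong X' W' :=
  generateDesc (Y := prolong X' W') (Quotient.map (Jet.map f φ) fun _ _ h => Jet.map_rel f φ h) <| by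
    rintro _ ⟨k, w, F, hF, hF', rfl⟩
    exact mem_generate ⟨k, φ.hom.toFun ∘ w, fun t => f.toFun ∘ F t, hF.map f,
      fun t => (hF' t).map f, rfl⟩

/-- The functor `X ⊗ · : 𝐖 ⥤ 𝐅𝐒`. -/
def prolongFunctor (X : Frol) : WeilAlg ⥤ Frol where
  obj W := prolong X W
  map φ := prolongMap (𝟙 X) φ
  map_id W := by
    ext x
    induction x using Quotient.ind
    rfl
  map_comp φ ψ := by
    ext x
    induction x using Quotient.ind
    rfl

end Frol

open Frol

/-- `X` is Weil exponentiable if `(X ⊗ (W₁ ⊗_∞ W₂))^Y ≅ (X ⊗ W₁)^Y ⊗ W₂`, naturally in the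
Frölicher space `Y` and the Weil algebras `W₁` and `W₂`. -/
def isWeilExponentiable : ObjectProperty Frol := fun X =>
  ∃ e : ∀ (Y : Frol) (W₁ W₂ : WeilAlg),
      exp (prolong X (W₁.tensor W₂)) Y ≅ prolong (exp (prolong X W₁) Y) W₂,
    ∀ (Y Y' : Frol) (g : Y' ⟶ Y) (W₁ W₁' W₂ W₂' : WeilAlg) (φ₁ : W₁ ⟶ W₁') (φ₂ : W₂ ⟶ W₂'),
      expMap (prolongMap (𝟙 X) (WeilAlg.tensorMap φ₁ φ₂)) g ≫ (e Y' W₁' W₂').hom =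
        (e Y W₁ W₂).hom ≫ prolongMap (expMap (prolongMap (𝟙 X) φ₁) g) φ₂

/-- The category `𝐅𝐒_𝐖𝐄` of Weil exponentiable Frölicher spaces and smooth mappings. -/
abbrev FrolWE := isWeilExponentiable.FullSubcategory

/-- `X` is microlinear if `X ⊗ ·` carries all finite limit diagrams of Weil algebras to limit
diagrams of Frölicher spaces. -/
def IsMicrolinear (X : Frol) : Prop :=
  ∀ (J : Type) [SmallCategory J] [FinCategory J] (F : J ⥤ WeilAlg) (c : Cone F),
    IsWeilLimit c → Nonempty (IsLimit ((prolongFunctor X).mapCone c))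

/-! ## The category `𝐃` and the functor `𝐉` -/

/-- The `C^∞`-algebras of the form `C^∞(ℝ^n) ⊗_∞ W` for a natural number `n` and a Weil
algebra `W`. -/
def isCahiers : ObjectProperty CInfAlg := fun A =>
  ∃ (n : ℕ) (W : WeilAlg), Nonempty (A ≅ CInfAlg.tensor (CInfAlg.free n) W.obj)

/-- The full subcategory `𝐃` of the category of `C^∞`-algebras. -/
abbrev CahiersAlg := isCahiers.FullSubcategory

/-- The functor `C^∞(ℝ^n) ⊗_∞ · : 𝐖 ⥤ 𝐃`. -/
def cahiers (n : ℕ) : WeilAlg ⥤ CahiersAlg where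
  obj W := ⟨CInfAlg.tensor (CInfAlg.free n) W.obj, n, W, ⟨Iso.refl _⟩⟩
  map φ := ObjectProperty.homMk (CInfAlg.tensorMap (𝟙 _) φ.hom)
  map_id _ := ObjectProperty.hom_ext _ (CInfAlg.tensorMap_id _ _)
  map_comp φ ψ := ObjectProperty.hom_ext _ (CInfAlg.tensorMap_comp (𝟙 _) (𝟙 _) φ.hom ψ.hom)

/-- A bifunctor `⊗ : 𝐅𝐒_𝐖𝐄 × 𝐃 ⥤ 𝐅𝐒_𝐖𝐄` (in curried form) with
`X ⊗ (C^∞(ℝ^n) ⊗_∞ W) ≅ X^(ℝ^n) ⊗ W`, naturally in `X` and in `W`. For `n = 0` this says that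
it extends the Weil prolongation. Nothing else is required of its action on morphisms of `𝐃`. -/
structure ProlongationBifunctor where
  functor : FrolWE ⥤ CahiersAlg ⥤ FrolWE
  iso : ∀ (n : ℕ) (X : FrolWE) (W : WeilAlg),
    ((functor.obj X).obj ((cahiers n).obj W)).obj ≅ prolong (exp X.obj (euclidean n)) W
  natural : ∀ (n : ℕ) {X X' : FrolWE} (f : X ⟶ X') {W W' : WeilAlg} (φ : W ⟶ W'),
    ((functor.map f).app ((cahiers n).obj W) ≫ (functor.obj X').map ((cahiers n).map φ)).hom ≫
        (iso n X' W').hom =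
      (iso n X W).hom ≫ prolongMap (expMap f.hom (𝟙 (euclidean n))) φ

/-- The functor `𝐉 : 𝐅𝐒_𝐖𝐄 ⥤ 𝐒𝐞𝐭𝐬^𝐃`, the exponential adjoint to the composite of the
bifunctor `⊗` and the underlying-set functor. -/
def embedding (T : ProlongationBifunctor) : FrolWE ⥤ CahiersAlg ⥤ Type :=
  T.functor ⋙ (Functor.whiskeringRight _ _ _).obj (isWeilExponentiable.ι ⋙ Frol.forget)

/-- The functor `W ↦ M ^ hom_𝐃(W, ·)`, where `W` is regarded as the object `C^∞(ℝ^0) ⊗_∞ W`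
of `𝐃`, and the exponential of two functors `G, M : 𝐃 ⥤ 𝐒𝐞𝐭𝐬` is
`(M ^ G)(C) = Nat(G × hom_𝐃(C, ·), M)`. (The values are in `Type 1` because `𝐃` is not small as
it stands.) -/
def weilExp (M : CahiersAlg ⥤ Type) : WeilAlg ⥤ CahiersAlg ⥤ Type 1 where
  obj W := (coyoneda.obj (Opposite.op ((cahiers 0).obj W))).functorHom M
  map φ :=
    { app := fun _ => ↾fun x =>
        (Functor.HomObj.ofNatTrans (coyoneda.map ((cahiers 0).map φ).op)).comp x
      naturality := fun _ _ _ => rfl }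
  map_id W := by
    ext C x E a z
    refine congrArg (ConcreteCategory.hom (x.app E a)) (?_ : (cahiers 0).map (𝟙 W) ≫ z = z)
    rw [CategoryTheory.Functor.map_id, Category.id_comp]
  map_comp φ ψ := by
    ext C x E a z
    refine congrArg (ConcreteCategory.hom (x.app E a))
      (?_ : (cahiers 0).map (φ ≫ ψ) ≫ z = (cahiers 0).map φ ≫ (cahiers 0).map ψ ≫ z)
    rw [CategoryTheory.Functor.map_comp, Category.assoc]

/-- A functor `M : 𝐃 ⥤ 𝐒𝐞𝐭𝐬` is microlinear if every finite limit diagram of Weil algebras is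
carried by `W ↦ M ^ hom_𝐃(W, ·)` to a limit diagram of functors on `𝐃`. -/
def IsMicrolinearFunctor (M : CahiersAlg ⥤ Type) : Prop :=
  ∀ (J : Type) [SmallCategory J] [FinCategory J] (F : J ⥤ WeilAlg) (c : Cone F),
    IsWeilLimit c → Nonempty (IsLimit ((weilExp M).mapCone c))

end

end WeilFrolicher

open WeilFrolicher

/-! Limits of functors on 𝐃 are computed pointwise, so fix C ≅ C^∞(ℝ^n) ⊗_∞ W' and let V run through
Weil algebras. In 𝐃 the objects C and V have the coproduct C^∞(ℝ^n) ⊗_∞ (W' ⊗_∞ V). Hence hom(V, ·)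
× hom(C, ·) is representable, and the Yoneda lemma (`weilExpEquiv`) identifies the value at C of the
exponential of M by hom(V, ·) with M(C^∞(ℝ^n) ⊗_∞ (W' ⊗_∞ V)), naturally in V.

For M = 𝐉(X) this set is X^(ℝ^n) ⊗ (W' ⊗_∞ V). Weil exponentiability with first Weil algebra ℝ,
together with X ⊗ ℝ ≅ X, turns it into the set of smooth mappings from ℝ^n to X ⊗ (ℝ ⊗_∞ (W' ⊗_∞
V)). Hom out of ℝ^n preserves limits, and X is microlinear, so it remains to see that V ↦ W' ⊗_∞ V
preserves limit diagrams of Weil algebras.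

For this, W ⊗_∞ B is shown to be B^(dim W) as a set, naturally in B (`WeilAlg.tensorCoords`); powers
of a limit of sets are limits. Coordinates exist because smooth operations do not lead out of the
image of the algebraic tensor product: a Hadamard expansion in the nilpotent direction terminates
(`WeilAlg.exists_op_liftAlg`). They are unique because the operations of W, written in coordinates,
are smooth functions and so make B^(dim W) a C^∞-algebra to which W ⊗_∞ B maps. -/

namespace WeilFrolicher

noncomputable section

/-! ### Hadamard's lemma with parameters -/

namespace CInfAlg

/-- The projection of `ℝ^(n+k)` to its first factor, as an endomorphism. -/
def leftPart {n k : ℕ} (x : Fin (n + k) → ℝ) : Fin (n + k) → ℝ :=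
  ∑ i : Fin n, x (Fin.castAdd k i) • Pi.single (Fin.castAdd k i) 1

theorem contDiff_leftPart {n k : ℕ} : ContDiff ℝ ∞ (leftPart (n := n) (k := k)) := by
  unfold leftPart
  fun_prop

theorem sub_leftPart {n k : ℕ} (x : Fin (n + k) → ℝ) :
    x - leftPart x = Fin.append (0 : Fin n → ℝ) (fun j => x (Fin.natAdd n j)) := by
  ext l
  refine Fin.addCases (fun i => ?_) (fun j => ?_) l
  · simp [leftPart, Finset.sum_apply, Pi.single_apply]
  · simp only [leftPart, Pi.sub_apply, Finset.sum_apply, Pi.smul_apply, Fin.append_right]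
    rw [Finset.sum_eq_zero, sub_zero]
    intro i _
    rw [Pi.single_eq_of_ne (by simp [Fin.ext_iff]; omega), smul_zero]

/-- Hadamard's lemma in the first group of variables, with the second one as parameters. -/
theorem hadamard_param {n k : ℕ} (h : (Fin (n + k) → ℝ) → ℝ) (hh : ContDiff ℝ ∞ h) :
    ∃ g : Fin n → (Fin (n + k) → ℝ) → ℝ, (∀ i, ContDiff ℝ ∞ (g i)) ∧
      ∀ x, h x = h (x - leftPart x) + ∑ i, x (Fin.castAdd k i) * g i x := by
  -- The segment from (0, b) to (a, b), where x = (a, b): only the first block is scaled.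
  let γ : (Fin (n + k) → ℝ) → ℝ → (Fin (n + k) → ℝ) := fun x t => x - leftPart x + t • leftPart x
  have hγ : ContDiff ℝ ∞ (fun p : (Fin (n + k) → ℝ) × ℝ => γ p.1 p.2) := by
    have := contDiff_leftPart (n := n) (k := k)
    fun_prop
  have hsm : ContDiff ℝ ∞ (fun p : (Fin (n + k) → ℝ) × ℝ => fderiv ℝ h (γ p.1 p.2)) := by
    have : ContDiff ℝ ∞ (fderiv ℝ h) := hh.fderiv_right (by simp)
    exact this.comp hγ
  refine ⟨fun i x => ∫ t in (0 : ℝ)..1, fderiv ℝ h (γ x t) (Pi.single (Fin.castAdd k i) 1),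
    fun i => contDiff_infty.2 fun m => contDiff_integral_aux m ℝ _
      (hsm.clm_apply contDiff_const), fun x => ?_⟩
  have hcont : ∀ v, Continuous (fun t : ℝ => fderiv ℝ h (γ x t) v) :=
    fun v => (hsm.continuous.comp (by fun_prop : Continuous fun t : ℝ => (x, t))).clm_apply
      continuous_const
  have key : ∫ t in (0 : ℝ)..1, fderiv ℝ h (γ x t) (leftPart x) = h x - h (x - leftPart x) := by
    have hder : ∀ t : ℝ, HasDerivAt (fun t : ℝ => h (γ x t))
        (fderiv ℝ h (γ x t) (leftPart x)) t := by
      intro t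
      have h1 := (hh.differentiable (by simp) (γ x t)).hasFDerivAt
      have h2 : HasDerivAt (γ x) (leftPart x) t := by
        have h3 := ((hasDerivAt_id t).smul_const (leftPart x)).const_add (x - leftPart x)
        rwa [one_smul] at h3
      exact h1.comp_hasDerivAt t h2
    rw [intervalIntegral.integral_eq_sub_of_hasDerivAt (fun t _ => hder t)
      ((hcont _).intervalIntegrable _ _)]
    simp [γ]
  have : ∀ t : ℝ, fderiv ℝ h (γ x t) (leftPart x) =
      ∑ i, x (Fin.castAdd k i) * fderiv ℝ h (γ x t) (Pi.single (Fin.castAdd k i) 1) := by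
    intro t
    conv_lhs => rw [leftPart]
    simp [map_sum]
  simp_rw [this] at key
  rw [intervalIntegral.integral_finsetSum
    (fun i _ => ((hcont _).const_mul _).intervalIntegrable _ _)] at key
  simp only [intervalIntegral.integral_const_mul] at key
  linarith

/-- The functions `h₀` and `g` are chosen before the algebra A. This uniformity makes the element Q
of `WeilAlg.exists_op_liftAlg` independent of the target. -/
theorem op_hadamard_param {n k : ℕ} (h : SmoothFn (n + k)) :
    ∃ (h₀ : SmoothFn k) (g : Fin n → SmoothFn (n + k)), ∀ (A : CInfAlg) (a : Fin n → A)
      (b : Fin k → A), A.op h (Fin.append a b) =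
        A.op h₀ b + ∑ i, a i * A.op (g i) (Fin.append a b) := by
  obtain ⟨g, hg, e⟩ := hadamard_param h.1 h.2
  have happ : ContDiff ℝ ∞ fun x : Fin k → ℝ => Fin.append (0 : Fin n → ℝ) x := by
    refine contDiff_pi.2 fun l => ?_
    refine Fin.addCases (fun i => ?_) (fun j => ?_) l
    · simpa using contDiff_const
    · simpa using contDiff_apply ℝ ℝ j
  let h₀ : SmoothFn k := ⟨fun x => h.1 (Fin.append 0 x), h.2.comp happ⟩
  refine ⟨h₀, fun i => ⟨g i, hg i⟩, fun A a b => ?_⟩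
  have h0 : A.op h₀ b = A.op (h₀.comp fun j => SmoothFn.proj (Fin.natAdd n j)) (Fin.append a b) := by
    rw [A.op_comp]
    exact congrArg _ (funext fun j => by rw [A.op_proj, Fin.append_right])
  have h1 : ∀ i, a i * A.op (⟨g i, hg i⟩ : SmoothFn (n + k)) (Fin.append a b) =
      A.op (⟨fun x => x (Fin.castAdd k i) * g i x, (contDiff_apply ℝ ℝ _).mul (hg i)⟩ :
        SmoothFn (n + k)) (Fin.append a b) := by
    intro i
    conv_lhs => rw [← Fin.append_left a b i, ← A.op_proj (Fin.castAdd k i) (Fin.append a b)]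
    rw [op_mul]
    rfl
  simp_rw [h1]
  rw [op_sum, h0, op_add]
  refine op_congr _ fun x => ?_
  rw [e x, sub_leftPart]
  rfl

/-- The homomorphism `W ⊗ B → T` of real algebras induced by homomorphisms of `C^∞`-algebras. -/
def liftAlg {W B T : CInfAlg} (i : W ⟶ T) (y : B ⟶ T) : W ⊗[ℝ] B →ₐ[ℝ] T :=
  Algebra.TensorProduct.lift i.toAlgHom y.toAlgHom fun _ _ => Commute.all _ _

theorem liftAlg_tmul {W B T : CInfAlg} (i : W ⟶ T) (y : B ⟶ T) (w : W) (b : B) :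
    liftAlg i y (w ⊗ₜ b) = i.toFun w * y.toFun b :=
  Algebra.TensorProduct.lift_tmul _ _ _ _ _

end CInfAlg

/-! ### Smooth operations on the algebraic tensor product -/

open CInfAlg

/-- The values of smooth operations on elements that come from `W ⊗ B` are again induced by an
element of `W ⊗ B`, which does not depend on the `C^∞`-algebra where they are evaluated. -/
theorem WeilAlg.exists_op_liftAlg (W : WeilAlg) (B : CInfAlg) {n : ℕ}
    (P : Fin n → W.obj ⊗[ℝ] B) (h : SmoothFn n) :
    ∃ Q : W.obj ⊗[ℝ] B, ∀ (T : CInfAlg) (i : W.obj ⟶ T) (y : B ⟶ T),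
      T.op h (fun j => liftAlg i y (P j)) = liftAlg i y Q := by
  have hfin := W.property.1
  -- The augmentation of W extended to B. Every p is 1 ⊗ ρ(p) plus an element of N, the ideal
  -- generated by the maximal ideal of W.
  let ρ : W.obj ⊗[ℝ] B →ₐ[ℝ] B :=
    Algebra.TensorProduct.lift ((Algebra.ofId ℝ B).comp W.aug) (AlgHom.id ℝ B)
      fun _ _ => Commute.all _ _
  let N : Ideal (W.obj ⊗[ℝ] B) :=
    (RingHom.ker W.aug.toRingHom).map (Algebra.TensorProduct.includeLeft (R := ℝ) (S := ℝ) (B := B))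
  have hmem : ∀ p : W.obj ⊗[ℝ] B, p - 1 ⊗ₜ ρ p ∈ N := by
    intro p
    induction p using TensorProduct.induction_on with
    | zero => simp
    | tmul w b =>
      have e : w ⊗ₜ[ℝ] b - 1 ⊗ₜ[ℝ] ρ (w ⊗ₜ b) =
          (1 ⊗ₜ b) * ((w - algebraMap ℝ W.obj (W.aug w)) ⊗ₜ[ℝ] (1 : B)) := by
        have h1 : ρ (w ⊗ₜ b) = W.aug w • b := by
          refine (Algebra.TensorProduct.lift_tmul _ _ _ _ _).trans ?_
          rw [Algebra.smul_def]
          rfl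
        rw [h1, Algebra.TensorProduct.tmul_mul_tmul, one_mul, mul_one, TensorProduct.sub_tmul,
          Algebra.algebraMap_eq_smul_one, TensorProduct.tmul_smul, TensorProduct.smul_tmul']
      rw [e]
      refine Ideal.mul_mem_left _ _ (Ideal.mem_map_of_mem _ ?_)
      refine (RingHom.mem_ker).2 ?_
      change W.aug (w - algebraMap ℝ W.obj (W.aug w)) = 0
      rw [map_sub, AlgHom.commutes]
      simp
    | add p q hp hq =>
      rw [map_add, TensorProduct.tmul_add, add_sub_add_comm]
      exact add_mem hp hq
  -- The maximal ideal of W is finitely generated and consists of nilpotent elements, so a power of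
  -- it vanishes; extension of ideals commutes with powers.
  have hN : IsNilpotent N := by
    have : IsNoetherianRing W.obj := IsNoetherianRing.of_finite ℝ W.obj
    obtain ⟨k, hk⟩ : IsNilpotent (RingHom.ker W.aug.toRingHom) := by
      rw [Ideal.FG.isNilpotent_iff_le_nilradical (IsNoetherian.noetherian _)]
      exact fun w hw => W.aug_nilpotent w hw
    exact ⟨k, by rw [← Ideal.map_pow, hk]; exact Ideal.map_bot⟩
  let ν : Fin n → W.obj ⊗[ℝ] B := fun j => P j - 1 ⊗ₜ ρ (P j)
  -- Taylor expansion in the nilpotent parts `ν`, with the components in B as parameters. Each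
  -- Hadamard step gains one power of N.
  have step : ∀ (k : ℕ) (H : SmoothFn (n + n)), ∃ Q : W.obj ⊗[ℝ] B,
      ∀ (T : CInfAlg) (i : W.obj ⟶ T) (y : B ⟶ T),
        T.op H (Fin.append (fun j => liftAlg i y (ν j)) fun j => y.toFun (ρ (P j))) -
          liftAlg i y Q ∈ (N ^ k).map (liftAlg i y) := by
    intro k
    induction k with
    | zero =>
      refine fun H => ⟨0, fun T i y => ?_⟩
      rw [pow_zero, Ideal.one_eq_top, Ideal.map_top]
      trivial
    | succ k ih =>
      intro H
      obtain ⟨H₀, G, hG⟩ := op_hadamard_param H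
      choose Q hQ using fun j => ih (G j)
      -- The term of order zero involves only elements of B, where it can be computed, as y commutes
      -- with operations; the coefficients of the `ν j` are approximated by induction.
      refine ⟨1 ⊗ₜ B.op H₀ (fun j => ρ (P j)) + ∑ j, ν j * Q j, fun T i y => ?_⟩
      have h1 : i.toFun 1 = 1 := map_one (Hom.toAlgHom i)
      rw [hG, map_add, liftAlg_tmul, h1, one_mul, y.map_op, map_sum]
      simp only [Function.comp_def, map_mul]
      rw [add_sub_add_left_eq_sub, ← Finset.sum_sub_distrib]
      refine sum_mem fun j _ => ?_
      rw [← mul_sub, pow_succ', Ideal.map_mul]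
      exact Ideal.mul_mem_mul (Ideal.mem_map_of_mem _ (hmem _)) (hQ j T i y)
  obtain ⟨k, hk⟩ := hN
  -- H(u, v) = h(u + v), since P j = ν j + 1 ⊗ ρ(P j).
  let H : SmoothFn (n + n) :=
    h.comp fun j => ⟨fun x => x (Fin.castAdd n j) + x (Fin.natAdd n j),
      (contDiff_apply ℝ ℝ _).add (contDiff_apply ℝ ℝ _)⟩
  obtain ⟨Q, hQ⟩ := step k H
  refine ⟨Q, fun T i y => ?_⟩
  have h2 := hQ T i y
  rw [hk, Ideal.zero_eq_bot, Ideal.map_bot, Ideal.mem_bot, sub_eq_zero] at h2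
  rw [← h2, T.op_comp]
  refine congrArg _ (funext fun j => ?_)
  have h3 := op_add (A := T) (SmoothFn.proj (Fin.castAdd n j)) (SmoothFn.proj (Fin.natAdd n j))
    (Fin.append (fun j => liftAlg i y (ν j)) fun j => y.toFun (ρ (P j)))
  rw [T.op_proj, T.op_proj, Fin.append_left, Fin.append_right] at h3
  refine Eq.trans ?_ h3
  have h1 : i.toFun 1 = 1 := map_one (Hom.toAlgHom i)
  simp only [ν]
  rw [map_sub, liftAlg_tmul, h1, one_mul, sub_add_cancel]

/-! ### Operations of a Weil algebra in coordinates -/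

namespace CInfAlg

theorem op_algebraMap {A : CInfAlg} {n : ℕ} (h : SmoothFn n) (r : Fin n → ℝ) :
    A.op h (fun i => algebraMap ℝ A (r i)) = algebraMap ℝ A (h.1 r) :=
  (A.op_comp h (fun i => SmoothFn.const 0 (r i)) Fin.elim0).symm

/-- Evaluation at a point, with values in the constants of a `C^∞`-algebra. -/
def evalAt {m : ℕ} (A : CInfAlg) (s : Fin m → ℝ) : free m ⟶ A where
  toFun g := algebraMap ℝ A (g.1 s)
  map_op h a := (op_algebraMap h fun i => (a i).1 s).symm

theorem algebraMap_mul_eq_op {A : CInfAlg} {n : ℕ} (r : ℝ) (k : Fin n) (v : Fin n → A) :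
    algebraMap ℝ A r * v k = A.op (⟨fun x => r * x k, contDiff_const.mul (contDiff_apply ℝ ℝ k)⟩ :
      SmoothFn n) v := by
  rw [algebraMap_eq r v, ← A.op_proj k v, op_mul]
  rfl

end CInfAlg

namespace WeilAlg

/-- The dimension of a Weil algebra. -/
abbrev dim (W : WeilAlg) : ℕ := Module.finrank ℝ W.obj

/-- A basis of a Weil algebra. -/
def basis (W : WeilAlg) : Module.Basis (Fin W.dim) ℝ W.obj :=
  have := W.property.1
  Module.finBasis ℝ W.obj

/-- The elements of `W` with given coordinates. -/
def ofCoords (W : WeilAlg) {n : ℕ} (s : Fin (n * W.dim) → ℝ) (j : Fin n) : W.obj :=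
  ∑ a, s (finProdFinEquiv (j, a)) • W.basis a

/-- Apply h to the generic tuple, whose coordinates are the coordinate functions in C^∞(ℝ^(n · dim
W)). One Q represents the result for all s at once, and evaluating its coefficients at s gives the
actual value, so the coordinates depend smoothly on s. -/
theorem contDiff_op (W : WeilAlg) {n : ℕ} (h : SmoothFn n) (b : Fin W.dim) :
    ContDiff ℝ ∞ fun s => W.basis.repr (W.obj.op h (W.ofCoords s)) b := by
  obtain ⟨Q, hQ⟩ := W.exists_op_liftAlg (free (n * W.dim))
    (fun j => ∑ a, W.basis a ⊗ₜ SmoothFn.proj (finProdFinEquiv (j, a))) h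
  have e : ∀ s, W.obj.op h (W.ofCoords s) = liftAlg (𝟙 W.obj) (evalAt W.obj s) Q := by
    intro s
    rw [← hQ]
    refine congrArg _ (funext fun j => ?_)
    rw [map_sum]
    refine Finset.sum_congr rfl fun a _ => ?_
    refine Eq.trans ?_ (liftAlg_tmul (𝟙 W.obj) (evalAt W.obj s) _ _).symm
    rw [Algebra.smul_def, mul_comm]
    rfl
  simp_rw [e]
  clear e hQ
  induction Q using TensorProduct.induction_on with
  | zero => simpa using contDiff_const
  | tmul w g =>
    have e : ∀ s, W.basis.repr (liftAlg (𝟙 W.obj) (evalAt W.obj s) (w ⊗ₜ g)) b =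
        g.1 s * W.basis.repr w b := by
      intro s
      have e' : liftAlg (𝟙 W.obj) (evalAt W.obj s) (w ⊗ₜ g) = g.1 s • w := by
        rw [liftAlg_tmul, Algebra.smul_def, mul_comm]
        rfl
      rw [e', map_smul]
      rfl
    simp_rw [e]
    exact g.2.mul contDiff_const
  | add p q hp hq =>
    simp only [map_add, Finsupp.add_apply]
    exact hp.add hq

/-- A smooth operation on `W` in coordinates. -/
def opCoord (W : WeilAlg) {n : ℕ} (h : SmoothFn n) (b : Fin W.dim) : SmoothFn (n * W.dim) :=
  ⟨_, W.contDiff_op h b⟩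

theorem opCoord_apply (W : WeilAlg) {n : ℕ} (h : SmoothFn n) (b : Fin W.dim)
    (s : Fin (n * W.dim) → ℝ) :
    (W.opCoord h b).1 s = W.basis.repr (W.obj.op h (W.ofCoords s)) b := rfl

/-- A tuple of coordinate vectors as a single tuple. -/
def flatten {B : Type} {n d : ℕ} (y : Fin n → Fin d → B) (k : Fin (n * d)) : B :=
  y (finProdFinEquiv.symm k).1 (finProdFinEquiv.symm k).2

theorem ofCoords_flatten (W : WeilAlg) {n : ℕ} (y : Fin n → Fin W.dim → ℝ) (j : Fin n) :
    W.ofCoords (flatten y) j = ∑ a, y j a • W.basis a := by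
  simp [ofCoords, flatten]

theorem opCoord_flatten_repr (W : WeilAlg) {n : ℕ} (h : SmoothFn n) (b : Fin W.dim)
    (w : Fin n → W.obj) :
    (W.opCoord h b).1 (flatten fun j a => W.basis.repr (w j) a) = W.basis.repr (W.obj.op h w) b := by
  rw [opCoord_apply]
  congr 3
  funext j
  rw [ofCoords_flatten, W.basis.sum_repr]

/-- The `C^∞`-algebra of tuples of coordinates in `B`, with the operations given by those of `W`. -/
def coordAlg (W : WeilAlg) (B : CInfAlg) : CInfAlg where
  carrier := Fin W.dim → B
  op h y := fun b => B.op (W.opCoord h b) (flatten y)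
  op_proj i y := by
    funext b
    have e : B.op (W.opCoord (SmoothFn.proj i) b) (flatten y) =
        B.op (SmoothFn.proj (finProdFinEquiv (i, b))) (flatten y) := by
      refine op_congr _ fun s => ?_
      rw [opCoord_apply, W.obj.op_proj, ofCoords]
      simp [SmoothFn.proj, Finsupp.single_apply]
    rw [e, B.op_proj]
    simp [flatten]
  op_comp h g y := by
    funext b
    refine Eq.trans ?_ (B.op_comp (W.opCoord h b) (flatten fun i b => W.opCoord (g i) b) (flatten y))
    -- The law over B is an identity of real smooth functions of the coordinates s, where it is the
    -- corresponding law of W.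
    refine op_congr _ fun s => ?_
    rw [opCoord_apply, W.obj.op_comp, ← opCoord_flatten_repr]
    rfl

/-- The inclusion of `W`. -/
def coordInl (W : WeilAlg) (B : CInfAlg) : W.obj ⟶ W.coordAlg B where
  toFun w a := algebraMap ℝ B (W.basis.repr w a)
  map_op h w := by
    funext b
    rw [← opCoord_flatten_repr, ← op_algebraMap]
    rfl

/-- The inclusion of `B`. -/
def coordInr (W : WeilAlg) (B : CInfAlg) : B ⟶ W.coordAlg B where
  toFun x a := algebraMap ℝ B (W.basis.repr 1 a) * x
  map_op {n} h v := by
    funext b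
    rw [algebraMap_eq _ v, op_mul]
    -- The coordinates of x j · 1 in W as functions of x. The claim reduces to the fact that
    -- operations of W act on constants as on real numbers.
    let g : Fin n → Fin W.dim → SmoothFn n := fun j a =>
      ⟨fun x => W.basis.repr 1 a * x j, contDiff_const.mul (contDiff_apply ℝ ℝ j)⟩
    have e : flatten (fun j a => algebraMap ℝ B (W.basis.repr 1 a) * v j) =
        fun k => B.op (flatten g k) v := by
      funext k
      exact algebraMap_mul_eq_op _ _ _
    change _ = B.op (W.opCoord h b) (flatten (fun j a => algebraMap ℝ B (W.basis.repr 1 a) * v j))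
    rw [e, ← B.op_comp]
    refine op_congr _ fun x => ?_
    have e' : (fun k => (flatten g k).1 x) =
        flatten fun j a => W.basis.repr (algebraMap ℝ W.obj (x j)) a := by
      funext k
      rw [flatten, flatten, Algebra.algebraMap_eq_smul_one, map_smul]
      exact mul_comm _ _
    change _ = (W.opCoord h b).1 (fun k => (flatten g k).1 x)
    rw [e', opCoord_flatten_repr, op_algebraMap, Algebra.algebraMap_eq_smul_one, map_smul]
    exact mul_comm _ _

/-! ### The tensor product with W as a power of sets -/

/-- The element of `W ⊗_∞ B` with given coordinates in `B`. -/
def tensorOfCoords (W : WeilAlg) (B : CInfAlg) (y : Fin W.dim → B) : CInfAlg.tensor W.obj B :=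
  ∑ a, (tensorInl W.obj B).toFun (W.basis a) * (tensorInr W.obj B).toFun (y a)

theorem tensorOfCoords_map (W : WeilAlg) {B B' : CInfAlg} (φ : B ⟶ B') (y : Fin W.dim → B) :
    (CInfAlg.tensorMap (𝟙 W.obj) φ).toFun (W.tensorOfCoords B y) =
      W.tensorOfCoords B' (φ.toFun ∘ y) := by
  refine (map_sum (Hom.toAlgHom (CInfAlg.tensorMap (𝟙 W.obj) φ)) _ _).trans ?_
  exact Finset.sum_congr rfl fun a _ => map_mul (Hom.toAlgHom (CInfAlg.tensorMap (𝟙 W.obj) φ)) _ _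

/-- The image of W ⊗ B contains W and B and is closed under smooth operations by
`exists_op_liftAlg`, so it is everything; then expand along the basis of W. -/
theorem tensorOfCoords_surjective (W : WeilAlg) (B : CInfAlg) :
    Function.Surjective (W.tensorOfCoords B) := by
  have h : ∀ x, ∃ Q, liftAlg (tensorInl W.obj B) (tensorInr W.obj B) Q = x := by
    intro x
    induction x using CInfAlg.tensor_induction with
    | hl w =>
      refine ⟨w ⊗ₜ 1, ?_⟩
      rw [liftAlg_tmul]
      exact (congrArg _ (map_one (Hom.toAlgHom (tensorInr W.obj B)))).trans (mul_one _)
    | hr b =>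
      refine ⟨1 ⊗ₜ b, ?_⟩
      rw [liftAlg_tmul]
      exact (congrArg (· * _) (map_one (Hom.toAlgHom (tensorInl W.obj B)))).trans (one_mul _)
    | hop h x hx =>
      choose P hP using hx
      obtain ⟨Q, hQ⟩ := W.exists_op_liftAlg B P h
      refine ⟨Q, ?_⟩
      rw [← hQ]
      simp_rw [hP]
  intro x
  obtain ⟨Q, rfl⟩ := h x
  obtain ⟨y, rfl⟩ : ∃ y : Fin W.dim → B, ∑ a, W.basis a ⊗ₜ[ℝ] y a = Q := by
    induction Q using TensorProduct.induction_on with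
    | zero => exact ⟨0, by simp⟩
    | tmul w b =>
      refine ⟨fun a => W.basis.repr w a • b, ?_⟩
      simp_rw [← TensorProduct.smul_tmul, ← TensorProduct.sum_tmul, W.basis.sum_repr]
    | add p q hp hq =>
      obtain ⟨y, rfl⟩ := hp
      obtain ⟨z, rfl⟩ := hq
      exact ⟨y + z, by simp [TensorProduct.tmul_add, Finset.sum_add_distrib]⟩
  refine ⟨y, ?_⟩
  rw [map_sum]
  simp_rw [liftAlg_tmul]
  rfl

end WeilAlg

namespace CInfAlg

/-- The pairing `∑ xᵢ yᵢ`. -/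
def dot (d : ℕ) : SmoothFn (d + d) :=
  ⟨fun x => ∑ a : Fin d, x (Fin.castAdd d a) * x (Fin.natAdd d a),
    ContDiff.sum fun _ _ => (contDiff_apply ℝ ℝ _).mul (contDiff_apply ℝ ℝ _)⟩

/-- With the whole sum written as one operation, a C^∞-homomorphism can be applied to it by a single
use of `map_op`. -/
theorem sum_mul_eq_op {A : CInfAlg} {d : ℕ} (u v : Fin d → A) :
    ∑ a, u a * v a = A.op (dot d) (Fin.append u v) := by
  have e : ∀ a, u a * v a = A.op (⟨fun x => x (Fin.castAdd d a) * x (Fin.natAdd d a),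
      (contDiff_apply ℝ ℝ _).mul (contDiff_apply ℝ ℝ _)⟩ : SmoothFn (d + d))
        (Fin.append u v) := by
    intro a
    have := op_mul (A := A) (SmoothFn.proj (Fin.castAdd d a)) (SmoothFn.proj (Fin.natAdd d a))
      (Fin.append u v)
    rwa [A.op_proj, A.op_proj, Fin.append_left, Fin.append_right] at this
  simp_rw [e]
  rw [op_sum]
  rfl

/-- The homomorphism from `C^∞(ℝ)` determined by an element. -/
def freeDesc {A : CInfAlg} (a : A) : free 1 ⟶ A where
  toFun g := A.op g fun _ => a
  map_op h g := A.op_comp h g _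

theorem freeDesc_proj {A : CInfAlg} (a : A) : (freeDesc a).toFun (SmoothFn.proj 0) = a :=
  A.op_proj _ _

theorem free_hom_ext {A : CInfAlg} {f g : free 1 ⟶ A}
    (h : f.toFun (SmoothFn.proj 0) = g.toFun (SmoothFn.proj 0)) : f = g := by
  have e : ∀ (f : free 1 ⟶ A) (p : SmoothFn 1),
      f.toFun p = A.op p fun _ => f.toFun (SmoothFn.proj 0) := by
    intro f p
    have e' : p = (free 1).op p fun _ => SmoothFn.proj 0 := by
      refine Subtype.ext (funext fun x => congrArg p.1 (funext fun i => ?_))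
      rw [Subsingleton.elim i 0]
      rfl
    exact (congrArg f.toFun e').trans (f.map_op _ _)
  exact hom_ext fun p => by rw [e f p, e g p, h]

end CInfAlg

/-- The universal property gives a homomorphism θ to the coordinate algebra on B^(dim W), and θ
recovers the coordinates. -/
theorem WeilAlg.tensorOfCoords_injective (W : WeilAlg) (B : CInfAlg) :
    Function.Injective (W.tensorOfCoords B) := by
  let θ := tensorDesc (W.coordInl B) (W.coordInr B)
  refine Function.LeftInverse.injective (g := θ.toFun) fun y => ?_
  refine (congrArg θ.toFun (sum_mul_eq_op (A := CInfAlg.tensor W.obj B) _ _)).trans ?_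
  rw [θ.map_op]
  funext b
  -- Coordinates of the basis vectors (constants) and of the elements x a · 1, as smooth functions
  -- of x. Pairing them in W gives ∑ x a • e_a, whose coordinates are x.
  let G : Fin (W.dim + W.dim) → Fin W.dim → SmoothFn W.dim :=
    Fin.append (fun a a' => SmoothFn.const _ (W.basis.repr (W.basis a) a')) fun a a' =>
      ⟨fun x => W.basis.repr 1 a' * x a, contDiff_const.mul (contDiff_apply ℝ ℝ a)⟩
  have e : ∀ k a', (θ.toFun (Fin.append (fun a => (tensorInl W.obj B).toFun (W.basis a))
      (fun a => (tensorInr W.obj B).toFun (y a)) k) : Fin W.dim → B) a' = B.op (G k a') y := by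
    intro k a'
    refine Fin.addCases (fun a => ?_) (fun a => ?_) k
    · simp only [G, Fin.append_left]
      exact algebraMap_eq _ _
    · simp only [G, Fin.append_right]
      exact algebraMap_mul_eq_op _ _ _
  refine (congrArg (B.op (W.opCoord (dot W.dim) b)) (funext fun k => e _ _)).trans ?_
  refine (B.op_comp (W.opCoord (dot W.dim) b)
    (fun k => G (finProdFinEquiv.symm k).1 (finProdFinEquiv.symm k).2) y).symm.trans ?_
  refine (op_congr _ fun x => ?_).trans (B.op_proj b y)
  have e' : (fun k => (G (finProdFinEquiv.symm k).1 (finProdFinEquiv.symm k).2).1 x) =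
      flatten fun j a => W.basis.repr
        (Fin.append (fun a => W.basis a) (fun a => algebraMap ℝ W.obj (x a)) j) a := by
    funext k
    rw [flatten]
    generalize (finProdFinEquiv.symm k).1 = j
    refine Fin.addCases (fun a => ?_) (fun a => ?_) j
    · simp only [G, Fin.append_left]
      rfl
    · simp only [G, Fin.append_right]
      rw [Algebra.algebraMap_eq_smul_one, map_smul]
      exact mul_comm _ _
  change (W.opCoord (dot W.dim) b).1
    (fun k => (G (finProdFinEquiv.symm k).1 (finProdFinEquiv.symm k).2).1 x) = x b
  rw [e', opCoord_flatten_repr, ← sum_mul_eq_op]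
  simp_rw [mul_comm (W.basis _), ← Algebra.smul_def]
  rw [W.basis.repr_sum_self]

/-- The coordinates of an element of `W ⊗_∞ B`. -/
def WeilAlg.tensorCoords (W : WeilAlg) (B : CInfAlg) :
    (Fin W.dim → B) ≃ CInfAlg.tensor W.obj B :=
  Equiv.ofBijective _ ⟨W.tensorOfCoords_injective B, W.tensorOfCoords_surjective B⟩

/-! ### Limits of sets, elementwise -/

universe u v w

/-- Every compatible family of elements over a diagram lifts uniquely to the vertex of a cone.
Here `S` is a covariant family of sets, with the action `act` of morphisms. -/
def UniqueLifts {K : Type v} [Category.{w} K] {J : Type} [SmallCategory J] {F : J ⥤ K}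
    (c : Cone F) {S : K → Type u} (act : ∀ k k' : K, (k ⟶ k') → S k → S k') : Prop :=
  ∀ s : ∀ j, S (F.obj j), (∀ {i j : J} (f : i ⟶ j), act _ _ (F.map f) (s i) = s j) →
    ∃! x : S c.pt, ∀ j, act c.pt _ (c.π.app j) x = s j

/-- Only compatibility of the bijections with the actions is used, not functoriality. The two
families may live in different universes, as needed for `weilExp`. -/
theorem UniqueLifts.of_equiv {K : Type v} [Category.{w} K] {J : Type} [SmallCategory J] {F : J ⥤ K}
    {c : Cone F} {S : K → Type u} {act : ∀ k k' : K, (k ⟶ k') → S k → S k'}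
    {S' : K → Type*} {act' : ∀ k k' : K, (k ⟶ k') → S' k → S' k'}
    (h : UniqueLifts c act) (e : ∀ k, S k ≃ S' k)
    (he : ∀ {k k' : K} (f : k ⟶ k') (x : S k), e k' (act _ _ f x) = act' _ _ f (e k x)) :
    UniqueLifts c act' := by
  intro s hs
  obtain ⟨x, hx, hu⟩ := h (fun j => (e _).symm (s j)) fun {i j} f =>
    (e _).injective (by rw [he, Equiv.apply_symm_apply, Equiv.apply_symm_apply, hs])
  refine ⟨e _ x, fun j => by rw [← he, hx, Equiv.apply_symm_apply], fun y hy => ?_⟩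
  refine (e _).symm_apply_eq.1 (hu _ fun j => (e _).injective ?_)
  rw [he, Equiv.apply_symm_apply, Equiv.apply_symm_apply]
  exact hy j

theorem UniqueLifts.pi {K : Type v} [Category.{w} K] {J : Type} [SmallCategory J] {F : J ⥤ K}
    {c : Cone F} {S : K → Type u} {act : ∀ k k' : K, (k ⟶ k') → S k → S k'}
    (h : UniqueLifts c act) (ι : Type) :
    UniqueLifts c (S := fun k => ι → S k) (fun _ _ f x i => act _ _ f (x i)) := by
  intro s hs
  choose x hx hu using fun i => h (fun j => s j i) fun f => congrFun (hs f) i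
  exact ⟨x, fun j => funext fun i => hx i j, fun y hy =>
    funext fun i => hu i (y i) fun j => congrFun (hy j) i⟩

/-- The algebra C^∞(ℝ) represents the underlying set, so limits of C^∞-algebras are limits of sets.
Conversely, uniqueness of lifts forces the lifted map to commute with all operations. -/
theorem isWeilLimit_iff {J : Type} [SmallCategory J] {F : J ⥤ WeilAlg} (c : Cone F) :
    IsWeilLimit c ↔ UniqueLifts c (S := fun W => W.obj) (fun _ _ φ => φ.hom.toFun) := by
  constructor
  · rintro ⟨h⟩ s hs
    let d : Cone (F ⋙ WeilAlg.incl) :=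
      { pt := free 1
        π := { app := fun j => freeDesc (s j)
               naturality := fun i j f => free_hom_ext (by
                refine Eq.trans (b := s j) (freeDesc_proj (s j)) ?_
                refine Eq.trans (hs f).symm ?_
                exact (congrArg _ (freeDesc_proj (s i))).symm) } }
    refine ⟨(h.lift d).toFun (SmoothFn.proj 0), fun j => ?_, fun y hy => ?_⟩
    · exact (congrFun (congrArg Hom.toFun (h.fac d j)) (SmoothFn.proj 0)).trans (freeDesc_proj (s j))
    · have : freeDesc y = h.lift d := h.uniq d _ fun j => free_hom_ext (by
        refine Eq.trans ?_ (freeDesc_proj (s j)).symm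
        exact (congrArg _ (freeDesc_proj y)).trans (hy j))
      rw [← this, freeDesc_proj]
  · intro h
    have hext : ∀ x y : c.pt.obj, (∀ j, (c.π.app j).hom.toFun x = (c.π.app j).hom.toFun y) →
        x = y := fun x y hxy => by
      refine (h (fun j => (c.π.app j).hom.toFun x) fun {i j} f => ?_).unique (fun _ => rfl)
        fun j => (hxy j).symm
      rw [← c.w f]
      rfl
    choose l hl using fun (d : Cone (F ⋙ WeilAlg.incl)) (x : d.pt) =>
      (h (fun j => (d.π.app j).toFun x) fun f =>
        congrFun (congrArg Hom.toFun (d.w f)) x).exists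
    refine ⟨{ lift := fun d => ⟨l d, fun {n} g a => hext _ _ fun j => ?_⟩
              fac := fun d j => hom_ext fun x => hl d x j
              uniq := fun d m hm => hom_ext fun x => hext _ _ fun j => ?_ }⟩
    · refine (hl d _ j).trans ((((d.π.app j).map_op _ _).trans ?_).trans
        ((c.π.app j).hom.map_op _ _).symm)
      exact congrArg _ (funext fun i => (hl d (a i) j).symm)
    · exact (congrFun (congrArg Hom.toFun (hm j)) x).trans (hl d x j).symm

/-- The functor `W ⊗_∞ · : 𝐖 ⥤ 𝐖`. -/
def WeilAlg.tensorFunctor (W : WeilAlg) : WeilAlg ⥤ WeilAlg where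
  obj V := W.tensor V
  map φ := WeilAlg.tensorMap (𝟙 W) φ
  map_id _ := ObjectProperty.hom_ext _ (CInfAlg.tensorMap_id _ _)
  map_comp φ ψ := ObjectProperty.hom_ext _ (CInfAlg.tensorMap_comp (𝟙 _) (𝟙 _) φ.hom ψ.hom)

/-- Tensoring with a Weil algebra preserves limit diagrams of Weil algebras. -/
theorem IsWeilLimit.tensor {J : Type} [SmallCategory J] {F : J ⥤ WeilAlg} {c : Cone F}
    (h : IsWeilLimit c) (W : WeilAlg) : IsWeilLimit (W.tensorFunctor.mapCone c) := by
  rw [isWeilLimit_iff] at h ⊢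
  -- In coordinates the functor W ⊗_∞ · is V ↦ V^(dim W) on underlying sets.
  exact UniqueLifts.of_equiv (S' := fun V : WeilAlg => (W.tensor V).obj)
    (act' := fun (V V' : WeilAlg) (φ : V ⟶ V') => (CInfAlg.tensorMap (𝟙 W.obj) φ.hom).toFun)
    (h.pi (Fin W.dim)) (fun V => W.tensorCoords V.obj)
    fun {_ _} φ y => (W.tensorOfCoords_map φ.hom y).symm

/-- Representable functors preserve limits. -/
theorem UniqueLifts.of_isLimit_mapCone {K : Type v} [Category.{w} K] {K' : Type*} [Category* K']
    {J : Type} [SmallCategory J] {F : J ⥤ K} {c : Cone F} {G : K ⥤ K'}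
    (h : IsLimit (G.mapCone c)) (Y : K') :
    UniqueLifts c (S := fun k => Y ⟶ G.obj k) (fun _ _ f u => u ≫ G.map f) := by
  intro s hs
  let d : Cone (F ⋙ G) :=
    { pt := Y
      π := { app := s
             naturality := fun i j f => (Category.id_comp _).trans (hs f).symm } }
  exact ⟨h.lift d, h.fac d, fun y hy => h.uniq d y hy⟩

theorem UniqueLifts.isLimit_mapCone {K : Type v} [Category.{w} K] {J : Type} [SmallCategory J]
    {F : J ⥤ K} {c : Cone F} {G : K ⥤ Type u}
    (h : UniqueLifts c (S := fun k => G.obj k) (fun _ _ f x => G.map f x)) :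
    Nonempty (IsLimit (G.mapCone c)) :=
  (Types.isLimit_iff _).2 fun s hs => h s fun f => hs f

/-! ### Prolongations of spaces of mappings -/

namespace Frol

@[simp] theorem prolongMap_id (X : Frol) (W : WeilAlg) :
    prolongMap (𝟙 X) (𝟙 W) = 𝟙 (prolong X W) := by
  ext x
  induction x using Quotient.ind
  rfl

theorem prolongMap_comp {X X' X'' : Frol} {W W' W'' : WeilAlg} (f : X ⟶ X') (f' : X' ⟶ X'')
    (φ : W ⟶ W') (φ' : W' ⟶ W'') :
    prolongMap (f ≫ f') (φ ≫ φ') = prolongMap f φ ≫ prolongMap f' φ' := by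
  ext x
  induction x using Quotient.ind
  rfl

@[simp] theorem expMap_id (X Y : Frol) : expMap (𝟙 X) (𝟙 Y) = 𝟙 (exp X Y) := rfl

theorem expMap_comp {X X' X'' Y : Frol} (f : X ⟶ X') (f' : X' ⟶ X'') :
    expMap (f ≫ f') (𝟙 Y) = expMap f (𝟙 Y) ≫ expMap f' (𝟙 Y) := rfl

/-- Isomorphic Frölicher spaces have isomorphic spaces of mappings. -/
def expIso {X X' : Frol} (i : X ≅ X') (Y : Frol) : exp X Y ≅ exp X' Y where
  hom := expMap i.hom (𝟙 Y)
  inv := expMap i.inv (𝟙 Y)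
  hom_inv_id := by rw [← expMap_comp, i.hom_inv_id, expMap_id]
  inv_hom_id := by rw [← expMap_comp, i.inv_hom_id, expMap_id]

/-- Isomorphic Frölicher spaces have isomorphic Weil prolongations. -/
def prolongIso {X X' : Frol} (i : X ≅ X') (W : WeilAlg) : prolong X W ≅ prolong X' W where
  hom := prolongMap i.hom (𝟙 W)
  inv := prolongMap i.inv (𝟙 W)
  hom_inv_id := by rw [← prolongMap_comp, i.hom_inv_id, Category.comp_id, prolongMap_id]
  inv_hom_id := by rw [← prolongMap_comp, i.inv_hom_id, Category.comp_id, prolongMap_id]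

/-- The bijection underlying an isomorphism of Frölicher spaces. -/
def isoEquiv {X X' : Frol} (i : X ≅ X') : X ≃ X' where
  toFun := i.hom.toFun
  invFun := i.inv.toFun
  left_inv x := congrFun (congrArg Frol.Hom.toFun i.hom_inv_id) x
  right_inv x := congrFun (congrArg Frol.Hom.toFun i.inv_hom_id) x

end Frol

/-- The Weil algebra `ℝ`. -/
def WeilAlg.real : WeilAlg where
  obj := CInfAlg.real
  property := by
    refine ⟨Module.Finite.of_surjective (Algebra.linearMap ℝ CInfAlg.real) fun x => ⟨x, rfl⟩,
      CInfAlg.toReal (𝟙 CInfAlg.real), fun w hw => ?_⟩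
    rw [show w = 0 from hw]
    exact IsNilpotent.zero

theorem WeilAlg.real_aug (x : WeilAlg.real.obj) : WeilAlg.real.aug x = x :=
  WeilAlg.real.aug.commutes x

open Frol

/-- The prolongation with `ℝ` is trivial. -/
def prolongReal (X : Frol) : X ≅ prolong X WeilAlg.real where
  hom :=
    { toFun := fun x => Quotient.mk _ ⟨0, Fin.elim0, fun _ => x, fun _ _ => contDiff_const⟩
      smooth := fun c hc => mem_generate ⟨0, Fin.elim0, fun t _ => c t,
        fun χ hχ => ((X.mem_curves c).1 hc χ hχ).comp contDiff_fst, _, rfl⟩ }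
  inv := generateDesc (Y := X) (Quotient.lift Jet.base fun _ _ h => h.1) <| by
    rintro _ ⟨k, w, F, hF, hF', rfl⟩
    exact (X.mem_curves _).2 fun χ hχ =>
      (hF χ hχ).comp (contDiff_id.prodMk (contDiff_const (c := fun i => WeilAlg.real.aug (w i))))
  hom_inv_id := rfl
  inv_hom_id := by
    ext x
    induction x using Quotient.ind with
    | _ j =>
      refine Quotient.sound ⟨rfl, fun χ hχ => ?_⟩
      -- Operations in ℝ are evaluations and the augmentation of ℝ is the identity, so a jet over ℝ
      -- is determined by its base point.
      change χ j.base = χ (j.f j.w)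
      exact congrArg (fun a => χ (j.f a)) (funext fun i => WeilAlg.real_aug _)

/-- For a Weil exponentiable microlinear space `X`, the functors
`W ↦ X^Y ⊗ (W' ⊗_∞ W)` carry finite limit diagrams of Weil algebras to limits of sets. -/
theorem uniqueLifts_prolong_exp {X : Frol} (hX : isWeilExponentiable X) (hm : IsMicrolinear X)
    (Y : Frol) (W' : WeilAlg) {J : Type} [SmallCategory J] [FinCategory J] {F : J ⥤ WeilAlg}
    {c : Cone F} (hc : IsWeilLimit c) :
    UniqueLifts c (S := fun V => prolong (exp X Y) (W'.tensor V))
      (fun _ _ φ => (prolongMap (𝟙 (exp X Y)) (WeilAlg.tensorMap (𝟙 W') φ)).toFun) := by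
  obtain ⟨e, he⟩ := hX
  -- The extra factor ℝ matches the form in which Weil exponentiability is stated. It need not be
  -- cancelled, since tensoring with ℝ also preserves limit diagrams.
  obtain ⟨hl⟩ := hm J _ _ ((hc.tensor W').tensor WeilAlg.real)
  have h₁ : UniqueLifts c
      (S := fun V => Y ⟶ prolong X (WeilAlg.real.tensor (W'.tensor V)))
      (fun _ _ φ u => u ≫ prolongMap (𝟙 X) (WeilAlg.tensorMap (𝟙 _) (WeilAlg.tensorMap (𝟙 W') φ))) :=
    UniqueLifts.of_isLimit_mapCone
      (G := W'.tensorFunctor ⋙ WeilAlg.real.tensorFunctor ⋙ prolongFunctor X) hl Y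
  -- Weil exponentiability with W₁ = ℝ; the points of the exponential are the smooth mappings out of
  -- Y.
  have h₂ : UniqueLifts c (S := fun V => prolong (exp (prolong X WeilAlg.real) Y) (W'.tensor V))
      (fun _ _ φ => (prolongMap (𝟙 _) (WeilAlg.tensorMap (𝟙 W') φ)).toFun) := by
    refine h₁.of_equiv (fun V => isoEquiv (e Y WeilAlg.real (W'.tensor V))) fun {V V'} φ x => ?_
    have := he Y Y (𝟙 Y) WeilAlg.real WeilAlg.real _ _ (𝟙 _) (WeilAlg.tensorMap (𝟙 W') φ)
    rw [prolongMap_id, expMap_id] at this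
    exact congrFun (congrArg Frol.Hom.toFun this) x
  refine h₂.of_equiv (fun V => isoEquiv (prolongIso (expIso (prolongReal X).symm Y) _))
    fun {V V'} φ x => ?_
  let f := (expIso (prolongReal X).symm Y).hom
  have : prolongMap (𝟙 _) (WeilAlg.tensorMap (𝟙 W') φ) ≫ prolongMap f (𝟙 _) =
      prolongMap f (𝟙 _) ≫ prolongMap (𝟙 _) (WeilAlg.tensorMap (𝟙 W') φ) := by
    rw [← prolongMap_comp, ← prolongMap_comp, Category.id_comp, Category.comp_id, Category.id_comp,
      Category.comp_id]
  exact congrFun (congrArg Frol.Hom.toFun this) x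

/-- The isomorphism of the bifunctor is natural along 1 ⊗ φ for Weil algebra homomorphisms φ, and no
other morphism of 𝐃 occurs in the diagram. -/
theorem uniqueLifts_embedding (T : ProlongationBifunctor) (X : FrolWE) (hX : IsMicrolinear X.obj)
    (n : ℕ) (W' : WeilAlg) {J : Type} [SmallCategory J] [FinCategory J] {F : J ⥤ WeilAlg}
    {c : Cone F} (hc : IsWeilLimit c) :
    UniqueLifts c (S := fun V => ((embedding T).obj X).obj ((cahiers n).obj (W'.tensor V)))
      (fun _ _ φ x => ((embedding T).obj X).map
        ((cahiers n).map (WeilAlg.tensorMap (𝟙 W') φ)) x) := by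
  refine (uniqueLifts_prolong_exp X.property hX (euclidean n) W' hc).of_equiv
    (fun V => (isoEquiv (T.iso n X (W'.tensor V))).symm) fun {V V'} φ x => ?_
  refine (Equiv.symm_apply_eq _).2 ?_
  have := T.natural n (𝟙 X) (WeilAlg.tensorMap (𝟙 W') φ)
  rw [CategoryTheory.Functor.map_id, NatTrans.id_app, Category.id_comp] at this
  refine Eq.trans ?_ (congrFun (congrArg Frol.Hom.toFun this)
    ((isoEquiv (T.iso n X (W'.tensor V))).symm x)).symm
  refine congrArg (prolongMap (𝟙 (exp X.obj (euclidean n))) (WeilAlg.tensorMap (𝟙 W') φ)).toFun ?_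
  exact ((isoEquiv (T.iso n X (W'.tensor V))).apply_symm_apply x).symm

/-! ### Coproducts with Weil algebras in 𝐃 and the Yoneda lemma -/

namespace CInfAlg

/-- The homomorphism from `C^∞(ℝ^0)` to a `C^∞`-algebra. -/
def freeZeroDesc (A : CInfAlg) : free 0 ⟶ A where
  toFun g := A.op g Fin.elim0
  map_op h g := A.op_comp h g _

/-- C^∞(ℝ^0) is initial, so a morphism out of C^∞(ℝ^0) ⊗_∞ V is determined by its restriction to V.
-/
theorem free_zero_hom_ext {A : CInfAlg} (f g : free 0 ⟶ A) : f = g := by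
  have e : ∀ (f : free 0 ⟶ A) (p : SmoothFn 0), f.toFun p = A.op p Fin.elim0 := by
    intro f p
    have e' : p = (free 0).op p Fin.elim0 :=
      Subtype.ext (funext fun x => congrArg p.1 (Subsingleton.elim _ _))
    refine (congrArg f.toFun e').trans ((f.map_op _ _).trans ?_)
    exact congrArg _ (Subsingleton.elim _ _)
  exact hom_ext fun p => by rw [e f p, e g p]

end CInfAlg

section Coproduct

variable {n : ℕ} {W' : WeilAlg} {C : CahiersAlg} (i : C.obj ≅ CInfAlg.tensor (free n) W'.obj)

/-- The inclusion of `C ≅ C^∞(ℝ^n) ⊗_∞ W'` in `C^∞(ℝ^n) ⊗_∞ (W' ⊗_∞ V)`. -/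
def coprodInl (V : WeilAlg) : C ⟶ (cahiers n).obj (W'.tensor V) :=
  ObjectProperty.homMk (i.hom ≫ CInfAlg.tensorMap (𝟙 _) (tensorInl W'.obj V.obj))

variable (n W') in
/-- The inclusion of `V` in `C^∞(ℝ^n) ⊗_∞ (W' ⊗_∞ V)`. -/
def coprodInr (V : WeilAlg) : (cahiers 0).obj V ⟶ (cahiers n).obj (W'.tensor V) :=
  ObjectProperty.homMk (tensorDesc (freeZeroDesc _) (tensorInr W'.obj V.obj ≫ tensorInr _ _))

/-- The universal property of `C^∞(ℝ^n) ⊗_∞ (W' ⊗_∞ V)` as a coproduct of `C` and `V`. -/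
def coprodDesc {V : WeilAlg} {E : CahiersAlg} (z : C ⟶ E) (u : (cahiers 0).obj V ⟶ E) :
    (cahiers n).obj (W'.tensor V) ⟶ E :=
  ObjectProperty.homMk (tensorDesc (tensorInl _ _ ≫ i.inv ≫ z.hom)
    (tensorDesc (tensorInr _ _ ≫ i.inv ≫ z.hom) (tensorInr _ _ ≫ u.hom)))

theorem coprodInl_desc {V : WeilAlg} {E : CahiersAlg} (z : C ⟶ E) (u : (cahiers 0).obj V ⟶ E) :
    coprodInl i V ≫ coprodDesc i z u = z := by
  refine ObjectProperty.hom_ext _ ?_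
  refine Eq.trans (b := i.hom ≫ i.inv ≫ z.hom) ?_ (i.hom_inv_id_assoc _)
  exact congrArg (i.hom ≫ ·) (tensor_hom_ext (f := CInfAlg.tensorMap (𝟙 _) (tensorInl W'.obj V.obj) ≫
    (coprodDesc i z u).hom) (g := i.inv ≫ z.hom) rfl rfl)

theorem coprodInr_desc {V : WeilAlg} {E : CahiersAlg} (z : C ⟶ E) (u : (cahiers 0).obj V ⟶ E) :
    coprodInr n W' V ≫ coprodDesc i z u = u :=
  ObjectProperty.hom_ext _ (tensor_hom_ext (free_zero_hom_ext _ _) rfl)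

/-- C accounts for the factors C^∞(ℝ^n) and W', and V for the third factor. -/
theorem coprod_hom_ext {V : WeilAlg} {E : CahiersAlg} {s t : (cahiers n).obj (W'.tensor V) ⟶ E}
    (hl : coprodInl i V ≫ s = coprodInl i V ≫ t)
    (hr : coprodInr n W' V ≫ s = coprodInr n W' V ≫ t) : s = t := by
  have hl' : CInfAlg.tensorMap (𝟙 _) (tensorInl W'.obj V.obj) ≫ s.hom =
      CInfAlg.tensorMap (𝟙 _) (tensorInl W'.obj V.obj) ≫ t.hom :=
    (cancel_epi i.hom).1 (congrArg (fun f => f.hom) hl)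
  have hr' := congrArg (fun f => tensorInr _ _ ≫ f.hom) hr
  refine ObjectProperty.hom_ext _ (tensor_hom_ext ?_ (tensor_hom_ext ?_ hr'))
  · exact congrArg (tensorInl (free n) W'.obj ≫ ·) hl'
  · exact congrArg (tensorInr (free n) W'.obj ≫ ·) hl'

theorem coprodInl_map {V V' : WeilAlg} (φ : V ⟶ V') :
    coprodInl i V ≫ (cahiers n).map (WeilAlg.tensorMap (𝟙 W') φ) = coprodInl i V' :=
  ObjectProperty.hom_ext _ (congrArg (i.hom ≫ ·) (tensor_hom_ext
    (f := CInfAlg.tensorMap (𝟙 _) (tensorInl W'.obj V.obj) ≫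
      ((cahiers n).map (WeilAlg.tensorMap (𝟙 W') φ)).hom)
    (g := CInfAlg.tensorMap (𝟙 _) (tensorInl W'.obj V'.obj)) rfl rfl))

theorem coprodInr_map {V V' : WeilAlg} (φ : V ⟶ V') :
    coprodInr n W' V ≫ (cahiers n).map (WeilAlg.tensorMap (𝟙 W') φ) =
      (cahiers 0).map φ ≫ coprodInr n W' V' :=
  ObjectProperty.hom_ext _ (tensor_hom_ext (free_zero_hom_ext _ _) rfl)

/-- The Yoneda lemma for the exponential of `M` by the functor represented by `V`. -/
def weilExpEquiv (M : CahiersAlg ⥤ Type) (V : WeilAlg) :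
    ((weilExp M).obj V).obj C ≃ M.obj ((cahiers n).obj (W'.tensor V)) where
  -- Evaluation at the universal pair of coproduct inclusions.
  toFun x := x.app _ (coprodInl i V) (coprodInr n W' V)
  invFun m :=
    { app := fun E z => ↾fun u => M.map (coprodDesc i z u) m
      naturality := fun {E E'} f z => by
        ext u
        have e : coprodDesc i (z ≫ f) (u ≫ f) = coprodDesc i z u ≫ f := by
          refine coprod_hom_ext i ?_ ?_
          · rw [coprodInl_desc, ← Category.assoc, coprodInl_desc]
          · rw [coprodInr_desc, ← Category.assoc, coprodInr_desc]
        refine (congrArg (fun t => M.map t m) e).trans ?_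
        exact ConcreteCategory.congr_hom (M.map_comp _ _) m }
  left_inv x := by
    refine Functor.functorHom_ext fun E z => ?_
    ext u
    -- Naturality along the morphism that carries the universal pair to (z, u).
    have h := ConcreteCategory.congr_hom (x.naturality (coprodDesc i z u) (coprodInl i V))
      (coprodInr n W' V)
    refine h.symm.trans ?_
    refine Eq.trans (b := x.app E (coprodInl i V ≫ coprodDesc i z u)
      (coprodInr n W' V ≫ coprodDesc i z u)) rfl ?_
    rw [coprodInl_desc, coprodInr_desc]
    rfl
  right_inv m := by
    have e : coprodDesc i (coprodInl i V) (coprodInr n W' V) = 𝟙 _ := by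
      refine coprod_hom_ext i ?_ ?_
      · rw [coprodInl_desc, Category.comp_id]
      · rw [coprodInr_desc, Category.comp_id]
    refine (congrArg (fun t => M.map t m) e).trans ?_
    exact ConcreteCategory.congr_hom (M.map_id _) m

/-- Both sides are the value of x at the pair of the inclusion of C and φ followed by the inclusion
of V', by naturality of x along the morphism that φ induces on coproducts. -/
theorem weilExpEquiv_map (M : CahiersAlg ⥤ Type) {V V' : WeilAlg} (φ : V ⟶ V')
    (x : ((weilExp M).obj V).obj C) :
    weilExpEquiv i M V' (((weilExp M).map φ).app C x) =
      M.map ((cahiers n).map (WeilAlg.tensorMap (𝟙 W') φ)) (weilExpEquiv i M V x) := by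
  have h := ConcreteCategory.congr_hom (x.naturality
    ((cahiers n).map (WeilAlg.tensorMap (𝟙 W') φ)) (coprodInl i V)) (coprodInr n W' V)
  refine Eq.trans ?_ h
  refine Eq.trans (b := x.app _ (coprodInl i V') ((cahiers 0).map φ ≫ coprodInr n W' V')) rfl ?_
  rw [← coprodInl_map i φ, ← coprodInr_map]
  rfl

end Coproduct

end

end WeilFrolicher

theorem theoremt4p7 (T : ProlongationBifunctor) (X : FrolWE) (hX : IsMicrolinear X.obj) :
    IsMicrolinearFunctor ((embedding T).obj X) := by
  intro J _ _ F c hc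
  -- Limits of functors on 𝐃 are detected at each object C.
  refine ⟨evaluationJointlyReflectsLimits _ fun C => Nonempty.some ?_⟩
  obtain ⟨n, W', ⟨i⟩⟩ := C.property
  have h : UniqueLifts c (S := fun V => ((weilExp ((embedding T).obj X)).obj V).obj C)
      (fun _ _ φ x => ((weilExp ((embedding T).obj X)).map φ).app C x) :=
    (uniqueLifts_embedding T X hX n W' hc).of_equiv
      (fun V => (weilExpEquiv i ((embedding T).obj X) V).symm) fun {V V'} φ x => by
        refine (Equiv.symm_apply_eq _).2 ?_
        rw [weilExpEquiv_map, Equiv.apply_symm_apply]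
  exact UniqueLifts.isLimit_mapCone
    (G := weilExp ((embedding T).obj X) ⋙ (evaluation CahiersAlg (Type 1)).obj C) h
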